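/- **Model.** Let $(\Omega,\mathscr F,P)$ be a probability space with a filtration $(\mathscr F_t)_{t\ge 0}$ satisfying the usual conditions, and let $\mathscr T$ be the set of stopping times with values in $[0,\infty]$. For each of two firms $i\in\{1,2\}$ (the other firm is called $j$) let $\pi^{0i},\pi^{Li},\pi^{Fi},\pi^{Bi}:\Omega\times[0,\infty)\to\mathbb R$ be product-measurable, $P\otimes dt$-integrable revenue streams whose accrued revenues $\int_0^t\pi_s\,ds$ are adapted, with $\pi^{Li}\ge\pi^{Bi}$ and $\pi^{0i}\ge\pi^{Fi}$ $P\otimes dt$-a.e. Relations between random variables hold almost surely. For $\tau\in\mathscr T$ put $$F^i_\tau=\int_0^\tau\pi^{0i}_s\,ds+\operatorname*{ess\,sup}_{\tau'\ge\tau}E\Bigl[\int_\tau^{\tau'}\pi^{Fi}_s\,ds+\int_{\tau'}^\infty\pi^{Bi}_s\,ds\Bigm|\mathscr F_\tau\Bigr],$$ let $\tau_F^i(\tau)$ be the latest stopping time attaining this value, and put $$L^i_\tau=\int_0^\tau\pi^{0i}_s\,ds+E\Bigl[\int_\tau^{\tau_F^j(\tau)}\pi^{Li}_s\,ds+\int_{\tau_F^j(\tau)}^\infty\pi^{Bi}_s\,ds\Bigm|\mathscr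 F_\tau\Bigr],\qquad M^i_\tau=\int_0^\tau\pi^{0i}_s\,ds+E\Bigl[\int_\tau^\infty\pi^{Bi}_s\,ds\Bigm|\mathscr F_\tau\Bigr].$$ In the subgame beginning at $\vartheta\in\mathscr T$ each firm $i$ chooses a plan $\tau^i\in\mathscr T$, $\tau^i\ge\vartheta$, and receives $$E\bigl[L^i_{\tau^i}\mathbf 1_{\{\tau^i<\tau^j\}}+F^i_{\tau^j}\mathbf 1_{\{\tau^i>\tau^j\}}+S^i_{\tau^i}\mathbf 1_{\{\tau^i=\tau^j\}}\bigm|\mathscr F_\vartheta\bigr].$$ In the basic game $S^i=M^i$ (firms planning the same date invest simultaneously). More generally, an arbitrary tie rule is allowed: $S^i_\tau=p^i_\tau L^i_\tau+p^j_\tau F^i_\tau+(1-p^1_\tau-p^2_\tau)M^i_\tau$, where $p^1_\tau,p^2_\tau\ge 0$, $p^1_\tau+p^2_\tau\le 1$, are $\mathscr F_\tau$-measurable probabilities that firm $1$ alone, respectively firm $2$ alone, invests first at $\tau$. Two plans $\tau^1,\tau^2\geq\vartheta$ are an *equilibrium* for the subgame if no firm $i$ can increase its payoff with positive probability by choosing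 any other stopping time $\tau\ge\vartheta$ instead of $\tau^i$. **Lemma.** Let $\vartheta\in\mathscr T$, $i\in\{1,2\}$ and $C\in\mathscr F$. 1. Suppose that on $C$, $\tau=\vartheta$ is the latest stopping time attaining $$\operatorname*{ess\,sup}_{\tau\ge\vartheta}E\bigl[L^i_\tau\bigm|\mathscr F_\vartheta\bigr],\tag{1}$$ i.e. $\vartheta$ attains (1) a.s. on $C$, and every stopping time $\tau\ge\vartheta$ satisfies $\tau=\vartheta$ a.s. wherever in $C$ it attains (1). Then in every equilibrium $(\tau^1,\tau^2)$ for the subgame beginning at $\vartheta$ some firm invests immediately on $C$: $\tau^1=\vartheta$ or $\tau^2=\vartheta$ a.s. on $C$. 2. If $\tau=\vartheta$ attains (1) a.s. on $C$, then a.s. on $C$ it also attains the unconstrained monopoly problem $$\operatorname*{ess\,sup}_{\tau\ge\vartheta}E\Bigl[\int_0^\tau\pi^{0i}_s\,ds+\int_\tau^\infty\pi^{Li}_s\,ds\Bigm|\mathscr F_\vartheta\Bigr].$$ -/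

import Mathlib

open MeasureTheory
open scoped NNReal

noncomputable section

namespace InvestmentTiming

variable {Ω : Type*} {mΩ : MeasurableSpace Ω}

/-! ### Time, filtration, stopping times -/

/-- Lebesgue measure `dt` on the time domain `[0, ∞)`. -/
def timeMeasure : Measure ℝ≥0 := Measure.comap (fun t : ℝ≥0 => (t : ℝ)) volume

/-- The usual conditions: the filtration is right-continuous, and every subset of a null set
(`P` is evaluated as an outer measure) is already contained in the initial σ-algebra. -/
structure UsualConditions (𝓕 : Filtration ℝ≥0 mΩ) (P : Measure Ω) : Prop where
  rightContinuous : 𝓕.IsRightContinuous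
  complete : ∀ s : Set Ω, P s = 0 → MeasurableSet[𝓕 0] s

/-- The set `𝒯` of all stopping times with values in `[0, ∞]`. -/
structure StoppingTime (𝓕 : Filtration ℝ≥0 mΩ) where
  time : Ω → WithTop ℝ≥0
  isStoppingTime : IsStoppingTime 𝓕 time

/-- The σ-algebra of the events known at a stopping time. -/
abbrev StoppingTime.sigma {𝓕 : Filtration ℝ≥0 mΩ} (τ : StoppingTime 𝓕) : MeasurableSpace Ω :=
  τ.isStoppingTime.measurableSpace

/-- The stopping times that are almost surely not earlier than `ϑ`. -/
def notBefore (P : Measure Ω) {𝓕 : Filtration ℝ≥0 mΩ} (ϑ : StoppingTime 𝓕) :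
    Set (StoppingTime 𝓕) :=
  {τ | ∀ᵐ ω ∂P, ϑ.time ω ≤ τ.time ω}

/-- The revenue `∫_a^b x_s ds` that the stream `x` accrues in the time interval `[a, b)`, for
random dates `a ≤ b` in `[0, ∞]`. -/
def accrued (x : Ω × ℝ≥0 → ℝ) (a b : Ω → WithTop ℝ≥0) (ω : Ω) : ℝ :=
  ∫ s in {s : ℝ≥0 | a ω ≤ (s : WithTop ℝ≥0) ∧ (s : WithTop ℝ≥0) < b ω}, x (ω, s) ∂timeMeasure

/-! ### Essential suprema and optimal stopping -/

/-- `g` is the essential supremum of the random variables `X k`, `k ∈ S`: the almost surely least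
random variable that is almost surely an upper bound of each of them. -/
structure IsEssSup {κ : Type*} (P : Measure Ω) (S : Set κ) (X : κ → Ω → ℝ) (g : Ω → ℝ) :
    Prop where
  aemeasurable : AEMeasurable g P
  upper : ∀ k ∈ S, X k ≤ᵐ[P] g
  least : ∀ h : Ω → ℝ, AEMeasurable h P → (∀ k ∈ S, X k ≤ᵐ[P] h) → g ≤ᵐ[P] h

open Classical in
/-- The essential supremum of a family of random variables (unique up to null sets; the value `0`
is used only if none exists). -/
def essSupOf {κ : Type*} (P : Measure Ω) (S : Set κ) (X : κ → Ω → ℝ) : Ω → ℝ :=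
  if h : ∃ g, IsEssSup P S X g then h.choose else 0

section Stopping

variable (P : Measure Ω) {𝓕 : Filtration ℝ≥0 mΩ}

/-- The value `ess sup_{τ ≥ ϑ} E[X(τ) | 𝓕_ϑ]` of stopping the payoff `X` optimally from `ϑ` on. -/
def stopValue (ϑ : StoppingTime 𝓕) (X : StoppingTime 𝓕 → Ω → ℝ) : Ω → ℝ :=
  essSupOf P (notBefore P ϑ) (fun τ => P[X τ | ϑ.sigma])

/-- The stopping time `τ ≥ ϑ` attains the value `ess sup_{τ ≥ ϑ} E[X(τ) | 𝓕_ϑ]` on the event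
`C`. -/
def AttainsOn (ϑ : StoppingTime 𝓕) (X : StoppingTime 𝓕 → Ω → ℝ) (τ : StoppingTime 𝓕)
    (C : Set Ω) : Prop :=
  τ ∈ notBefore P ϑ ∧ ∀ᵐ ω ∂P, ω ∈ C → (P[X τ | ϑ.sigma]) ω = stopValue P ϑ X ω

/-- On the event `C`, `τ` is the latest stopping time attaining
`ess sup_{τ ≥ ϑ} E[X(τ) | 𝓕_ϑ]`: it attains the value there, and, up to null sets, wherever in `C`
another stopping time attains the value, that one is not later than `τ`. -/
def IsLatestOn (ϑ : StoppingTime 𝓕) (X : StoppingTime 𝓕 → Ω → ℝ) (τ : StoppingTime 𝓕)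
    (C : Set Ω) : Prop :=
  AttainsOn P ϑ X τ C ∧
    ∀ σ ∈ notBefore P ϑ, ∀ᵐ ω ∂P, ω ∈ C →
      (P[X σ | ϑ.sigma]) ω = stopValue P ϑ X ω → σ.time ω ≤ τ.time ω

end Stopping

/-! ### The revenue streams -/

/-- A revenue stream: product-measurable, `P ⊗ dt`-integrable, with adapted accrued revenues. -/
structure IsRevenueStream (P : Measure Ω) (𝓕 : Filtration ℝ≥0 mΩ) (x : Ω × ℝ≥0 → ℝ) : Prop where
  measurable : Measurable x
  integrable : Integrable x (P.prod timeMeasure)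
  adapted : ∀ t : ℝ≥0,
    Measurable[𝓕 t] (accrued x (fun _ => ((0 : ℝ≥0) : WithTop ℝ≥0)) (fun _ => (t : WithTop ℝ≥0)))

/-- The (discounted) revenue streams of the two firms `i : Fin 2`: `pi0 i` while no firm has
invested, `piL i` once only firm `i` has invested, `piF i` once only the opponent has invested,
`piB i` once both firms have invested. Investment by a single firm never benefits the other. -/
structure Revenues (P : Measure Ω) (𝓕 : Filtration ℝ≥0 mΩ) where
  pi0 : Fin 2 → Ω × ℝ≥0 → ℝ
  piL : Fin 2 → Ω × ℝ≥0 → ℝ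
  piF : Fin 2 → Ω × ℝ≥0 → ℝ
  piB : Fin 2 → Ω × ℝ≥0 → ℝ
  stream0 : ∀ i, IsRevenueStream P 𝓕 (pi0 i)
  streamL : ∀ i, IsRevenueStream P 𝓕 (piL i)
  streamF : ∀ i, IsRevenueStream P 𝓕 (piF i)
  streamB : ∀ i, IsRevenueStream P 𝓕 (piB i)
  piB_le_piL : ∀ i, piB i ≤ᵐ[P.prod timeMeasure] piL i
  piF_le_pi0 : ∀ i, piF i ≤ᵐ[P.prod timeMeasure] pi0 i

/-- The opponent of firm `i`. -/
def opponent (i : Fin 2) : Fin 2 := 1 - i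

/-- The certain date `0`. -/
def timeZero : Ω → WithTop ℝ≥0 := fun _ => ((0 : ℝ≥0) : WithTop ℝ≥0)

/-- The date `∞` (never). -/
def timeInfty : Ω → WithTop ℝ≥0 := fun _ => ⊤

/-! ### Payoffs -/

namespace Revenues

variable {P : Measure Ω} {𝓕 : Filtration ℝ≥0 mΩ} (R : Revenues P 𝓕)

/-- Revenue of firm `i` from `τ` on if the opponent invests at `τ` and firm `i` follows at `σ`. -/
def followerReward (i : Fin 2) (τ σ : StoppingTime 𝓕) (ω : Ω) : ℝ :=
  accrued (R.piF i) τ.time σ.time ω + accrued (R.piB i) σ.time timeInfty ω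

/-- The follower payoff `F^i(τ)`. -/
def follower (i : Fin 2) (τ : StoppingTime 𝓕) (ω : Ω) : ℝ :=
  accrued (R.pi0 i) timeZero τ.time ω + stopValue P τ (R.followerReward i τ) ω

open Classical in
/-- The follower reaction time `τ_F^i(τ)`: the latest stopping time attaining `F^i(τ)` (unique up
to null sets; the alternative `τ` is used only if none exists). -/
def followerTime (i : Fin 2) (τ : StoppingTime 𝓕) : StoppingTime 𝓕 :=
  if h : ∃ σ, IsLatestOn P τ (R.followerReward i τ) σ Set.univ then h.choose else τ

/-- Revenue of firm `i` from `τ` on if it invests first at `τ` and the opponent follows at its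
reaction time. -/
def leaderReward (i : Fin 2) (τ : StoppingTime 𝓕) (ω : Ω) : ℝ :=
  accrued (R.piL i) τ.time (R.followerTime (opponent i) τ).time ω
    + accrued (R.piB i) (R.followerTime (opponent i) τ).time timeInfty ω

/-- The leader payoff `L^i(τ)`. -/
def leader (i : Fin 2) (τ : StoppingTime 𝓕) (ω : Ω) : ℝ :=
  accrued (R.pi0 i) timeZero τ.time ω + (P[R.leaderReward i τ | τ.sigma]) ω

/-- The payoff `M^i(τ)` from simultaneous investment. -/
def simultaneous (i : Fin 2) (τ : StoppingTime 𝓕) (ω : Ω) : ℝ :=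
  accrued (R.pi0 i) timeZero τ.time ω
    + (P[accrued (R.piB i) τ.time timeInfty | τ.sigma]) ω

/-- The payoff of a monopolist who invests at `τ` and never faces a follower. -/
def monopoly (i : Fin 2) (τ : StoppingTime 𝓕) (ω : Ω) : ℝ :=
  accrued (R.pi0 i) timeZero τ.time ω + accrued (R.piL i) τ.time timeInfty ω

end Revenues

/-! ### The timing game -/

/-- A tie rule: what happens at a date `τ` for which both firms have planned to invest. Given the
information at `τ`, firm `i` alone invests first with probability `lead i τ` (the other then becomes
follower), and both invest simultaneously with probability `both τ`. -/
structure TieRule (𝓕 : Filtration ℝ≥0 mΩ) where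
  lead : Fin 2 → StoppingTime 𝓕 → Ω → ℝ
  both : StoppingTime 𝓕 → Ω → ℝ
  lead_measurable : ∀ i τ, Measurable[τ.sigma] (lead i τ)
  both_measurable : ∀ τ, Measurable[τ.sigma] (both τ)
  lead_nonneg : ∀ i τ ω, 0 ≤ lead i τ ω
  both_nonneg : ∀ τ ω, 0 ≤ both τ ω
  sum_eq_one : ∀ τ ω, lead 0 τ ω + lead 1 τ ω + both τ ω = 1

/-- The basic tie rule: firms that plan the same date invest simultaneously. -/
def TieRule.simultaneous (𝓕 : Filtration ℝ≥0 mΩ) : TieRule 𝓕 where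
  lead _ _ _ := 0
  both _ _ := 1
  lead_measurable _ _ := measurable_const
  both_measurable _ := measurable_const
  lead_nonneg _ _ _ := le_rfl
  both_nonneg _ _ := zero_le_one
  sum_eq_one _ _ := by norm_num

namespace Revenues

variable {P : Measure Ω} {𝓕 : Filtration ℝ≥0 mΩ} (R : Revenues P 𝓕)

/-- Payoff of firm `i` if both firms plan to invest at `τ`; it is `M^i(τ)` under the basic tie
rule. -/
def tiePayoff (tie : TieRule 𝓕) (i : Fin 2) (τ : StoppingTime 𝓕) (ω : Ω) : ℝ :=
  tie.lead i τ ω * R.leader i τ ω + tie.lead (opponent i) τ ω * R.follower i τ ω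
    + tie.both τ ω * R.simultaneous i τ ω

/-- Payoff of firm `i` at the first investment, if it plans to invest at `τ` and its opponent at
`σ`. -/
def outcome (tie : TieRule 𝓕) (i : Fin 2) (τ σ : StoppingTime 𝓕) : Ω → ℝ :=
  {ω | τ.time ω < σ.time ω}.indicator (R.leader i τ)
    + {ω | σ.time ω < τ.time ω}.indicator (R.follower i σ)
    + {ω | τ.time ω = σ.time ω}.indicator (R.tiePayoff tie i τ)

/-- Conditional expected payoff of firm `i` in the subgame beginning at `ϑ`. -/
def subgamePayoff (tie : TieRule 𝓕) (ϑ : StoppingTime 𝓕) (i : Fin 2) (τ σ : StoppingTime 𝓕) :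
    Ω → ℝ :=
  P[R.outcome tie i τ σ | ϑ.sigma]

/-- The plans `plan 0`, `plan 1` are an equilibrium for the subgame beginning at `ϑ`: they are
feasible, and no firm can increase its payoff with positive probability by another plan. -/
def IsSubgameEquilibrium (tie : TieRule 𝓕) (ϑ : StoppingTime 𝓕)
    (plan : Fin 2 → StoppingTime 𝓕) : Prop :=
  (∀ i, plan i ∈ notBefore P ϑ) ∧
    ∀ i, ∀ τ ∈ notBefore P ϑ,
      R.subgamePayoff tie ϑ i τ (plan (opponent i))
        ≤ᵐ[P] R.subgamePayoff tie ϑ i (plan i) (plan (opponent i))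

end Revenues

end InvestmentTiming

end

noncomputable section

namespace InvestmentTiming

open Filter Topology

variable {Ω : Type*} {mΩ : MeasurableSpace Ω}

/-! ### Lebesgue measure on the time domain -/

/-! For part 1, consider the first planned date `κ = min τ¹ τ²`. Whatever happens there, firm `i`
receives `L`, `F`, or a convex combination of `L`, `F`, `M`. Simultaneous investment is no better
than leading, since `piB ≤ piL` until the opponent reacts. Following need not be comparable with
leading at `κ`, but it is no better than leading at the firm's own follower reaction time: `piF ≤
pi0` up to that date and `piB ≤ piL` afterwards (`follower_le_delayedLeader`). So every plan of firm
`i` is dominated by leading at some `ρ ≥ κ` (`exists_subgamePayoff_le`). Where both plans are later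
than `ϑ`, deviating to `ϑ` earns `L_ϑ`, which on `C` is the value of the leader's problem. In
equilibrium `ρ` then attains this value too, although `ρ ≥ κ > ϑ`, and this contradicts `ϑ` being
the latest solution.

For part 2, the monopoly payoff is the leader payoff plus the revenue lost to the follower, which is
`piL - piB ≥ 0` accrued from the opponent's reaction on. A later lead meets a later reaction, so
this loss is largest at `ϑ`. Both summands are therefore maximal at `ϑ`.

Both parts need the reaction time to exist, to depend only on the date reacted to, and to be
monotone in it. The follower at `τ` in effect maximizes the expectation of `piF - piB` accrued on
`[0, c)` over `c ≥ τ`, so `τ` enters only through the constraint. This functional `gain` is modular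
under pathwise maxima and minima and continuous along monotone sequences. These two properties give
a latest maximizer (`exists_isLatestMax`), and an exchange argument gives its monotonicity
(`IsLatestMax.le_of_le`). -/

theorem measurableEmbedding_coe_nnreal : MeasurableEmbedding (fun t : ℝ≥0 => (t : ℝ)) :=
  MeasurableEmbedding.subtype_coe measurableSet_Ici

instance instSigmaFiniteTimeMeasure : SigmaFinite timeMeasure := by
  refine SigmaFinite.of_map _ measurableEmbedding_coe_nnreal.measurable.aemeasurable ?_
  rw [timeMeasure, measurableEmbedding_coe_nnreal.map_comap]
  infer_instance

instance instNullSingletonClassTimeMeasure : NullSingletonClass timeMeasure where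
  measure_singleton t := by
    rw [timeMeasure, measurableEmbedding_coe_nnreal.comap_apply]
    simp

/-! ### Accrued revenue -/

theorem measurableSet_accrualWindow {a b : Ω → WithTop ℝ≥0} (ha : Measurable a)
    (hb : Measurable b) :
    MeasurableSet {p : Ω × ℝ≥0 | a p.1 ≤ (p.2 : WithTop ℝ≥0) ∧ (p.2 : WithTop ℝ≥0) < b p.1} := by
  have h : Measurable fun p : Ω × ℝ≥0 => (p.2 : WithTop ℝ≥0) :=
    WithTop.measurable_coe.comp measurable_snd
  exact (measurableSet_le (ha.comp measurable_fst) h).inter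
    (measurableSet_lt h (hb.comp measurable_fst))

theorem measurableSet_timeWindow (a b : WithTop ℝ≥0) :
    MeasurableSet {s : ℝ≥0 | a ≤ (s : WithTop ℝ≥0) ∧ (s : WithTop ℝ≥0) < b} :=
  (measurableSet_le measurable_const WithTop.measurable_coe).inter
    (measurableSet_lt WithTop.measurable_coe measurable_const)

theorem accrued_eq_integral_indicator (x : Ω × ℝ≥0 → ℝ) (a b : Ω → WithTop ℝ≥0) (ω : Ω) :
    accrued x a b ω = ∫ s, {p : Ω × ℝ≥0 | a p.1 ≤ (p.2 : WithTop ℝ≥0) ∧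
      (p.2 : WithTop ℝ≥0) < b p.1}.indicator x (ω, s) ∂timeMeasure := by
  rw [accrued, ← integral_indicator (measurableSet_timeWindow _ _)]
  rfl

theorem accrued_congr {x : Ω × ℝ≥0 → ℝ} {a b a' b' : Ω → WithTop ℝ≥0} {ω : Ω}
    (ha : a ω = a' ω) (hb : b ω = b' ω) : accrued x a b ω = accrued x a' b' ω := by
  simp only [accrued, ha, hb]

theorem accrued_add {x : Ω × ℝ≥0 → ℝ} {a b c : Ω → WithTop ℝ≥0} {ω : Ω}
    (hx : Integrable (fun s => x (ω, s)) timeMeasure) (hab : a ω ≤ b ω) (hbc : b ω ≤ c ω) :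
    accrued x a b ω + accrued x b c ω = accrued x a c ω := by
  rw [accrued, accrued, accrued, ← setIntegral_union _ (measurableSet_timeWindow _ _)
    hx.integrableOn hx.integrableOn]
  · congr 2
    ext s
    simp only [Set.mem_union, Set.mem_ofPred_eq]
    constructor
    · rintro (⟨h1, h2⟩ | ⟨h1, h2⟩)
      · exact ⟨h1, h2.trans_le hbc⟩
      · exact ⟨hab.trans h1, h2⟩
    · rintro ⟨h1, h2⟩
      rcases lt_or_ge (s : WithTop ℝ≥0) (b ω) with h | h
      · exact Or.inl ⟨h1, h⟩
      · exact Or.inr ⟨h, h2⟩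
  · rw [Set.disjoint_left]
    rintro s ⟨_, h1⟩ ⟨h2, _⟩
    exact absurd h1 (not_lt.2 h2)

theorem accrued_sub {x y : Ω × ℝ≥0 → ℝ} {a b : Ω → WithTop ℝ≥0} {ω : Ω}
    (hx : Integrable (fun s => x (ω, s)) timeMeasure)
    (hy : Integrable (fun s => y (ω, s)) timeMeasure) :
    accrued (x - y) a b ω = accrued x a b ω - accrued y a b ω :=
  integral_sub hx.integrableOn hy.integrableOn

theorem accrued_mono_stream {x y : Ω × ℝ≥0 → ℝ} {a b : Ω → WithTop ℝ≥0} {ω : Ω}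
    (hx : Integrable (fun s => x (ω, s)) timeMeasure)
    (hy : Integrable (fun s => y (ω, s)) timeMeasure)
    (h : ∀ᵐ s ∂timeMeasure, x (ω, s) ≤ y (ω, s)) : accrued x a b ω ≤ accrued y a b ω :=
  integral_mono_ae hx.integrableOn hy.integrableOn (ae_restrict_of_ae h)

theorem abs_accrued_le {x : Ω × ℝ≥0 → ℝ} {a b : Ω → WithTop ℝ≥0} {ω : Ω}
    (hx : Integrable (fun s => x (ω, s)) timeMeasure) :
    |accrued x a b ω| ≤ ∫ s, |x (ω, s)| ∂timeMeasure := by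
  refine (abs_integral_le_integral_abs).trans ?_
  exact setIntegral_le_integral hx.abs (Eventually.of_forall fun _ => abs_nonneg _)

theorem integrable_accrued {P : Measure Ω} [IsProbabilityMeasure P] {x : Ω × ℝ≥0 → ℝ}
    (hx : Integrable x (P.prod timeMeasure)) {a b : Ω → WithTop ℝ≥0} (ha : Measurable a)
    (hb : Measurable b) : Integrable (accrued x a b) P := by
  have h := (hx.indicator (measurableSet_accrualWindow ha hb)).integral_prod_left
  exact h.congr (Eventually.of_forall fun ω => (accrued_eq_integral_indicator x a b ω).symm)

/-! ### Essential suprema -/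

/-- Every family of measurable events has a countable subfamily whose union almost surely contains
each of its members. -/
theorem exists_seq_union_ae_contains {κ : Type*} (P : Measure Ω) [IsProbabilityMeasure P]
    {S : Set κ} (hS : S.Nonempty) (A : κ → Set Ω) (hA : ∀ k ∈ S, MeasurableSet (A k)) :
    ∃ s : ℕ → κ, (∀ n, s n ∈ S) ∧ ∀ k ∈ S, ∀ᵐ ω ∂P, ω ∈ A k → ∃ n, ω ∈ A (s n) := by
  -- Exhaustion: the supremum of the probabilities of countable unions is attained, by merging a
  -- maximizing sequence of subfamilies into one through the pairing function.
  let V : Set ENNReal := {v | ∃ s : ℕ → κ, (∀ n, s n ∈ S) ∧ v = P (⋃ n, A (s n))}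
  have hV : V.Nonempty := by
    obtain ⟨k, hk⟩ := hS
    exact ⟨_, fun _ => k, fun _ => hk, rfl⟩
  obtain ⟨u, -, hu, huV⟩ := exists_seq_tendsto_sSup hV (OrderTop.bddAbove V)
  choose s hsS hsu using huV
  let t : ℕ → κ := fun n => s n.unpair.1 n.unpair.2
  have ht : ∀ n, t n ∈ S := fun n => hsS _ _
  have htV : P (⋃ n, A (t n)) = sSup V := by
    refine le_antisymm (le_sSup ⟨t, ht, rfl⟩) (le_of_tendsto' hu fun m => ?_)
    rw [hsu]
    refine measure_mono (Set.iUnion_subset fun n => ?_)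
    refine Set.subset_iUnion_of_subset (Nat.pair m n) ?_
    simp [t]
  refine ⟨t, ht, fun k hk => ?_⟩
  -- Prepending `k` to the optimal sequence cannot raise the probability of the union, so `A k` adds
  -- only a null set.
  let r : ℕ → κ := fun n => Nat.casesOn n k t
  have hr : ∀ n, r n ∈ S := by
    rintro (_ | n)
    · exact hk
    · exact ht n
  have hrU : ⋃ n, A (r n) = (⋃ n, A (t n)) ∪ (A k \ ⋃ n, A (t n)) := by
    rw [Set.union_sdiff_self, Set.union_comm]
    ext ω
    simp only [Set.mem_iUnion, Set.mem_union]
    constructor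
    · rintro ⟨_ | n, h⟩
      · exact Or.inl h
      · exact Or.inr ⟨n, h⟩
    · rintro (h | ⟨n, h⟩)
      · exact ⟨0, h⟩
      · exact ⟨n + 1, h⟩
  have hmeas : MeasurableSet (⋃ n, A (t n)) := MeasurableSet.iUnion fun n => hA _ (ht n)
  have h1 : P (⋃ n, A (t n)) + P (A k \ ⋃ n, A (t n)) ≤ P (⋃ n, A (t n)) := by
    rw [← measure_union Set.disjoint_sdiff_right ((hA k hk).diff hmeas), ← hrU, htV]
    exact le_sSup ⟨r, hr, rfl⟩
  have h2 : P (A k \ ⋃ n, A (t n)) = 0 := by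
    by_contra hne
    exact absurd h1 (not_le.2 (ENNReal.lt_add_right (measure_ne_top _ _) hne))
  rw [measure_eq_zero_iff_ae_notMem] at h2
  filter_upwards [h2] with ω hω hk
  by_contra hn
  exact hω ⟨hk, by simpa using hn⟩

/-- A countable subfamily that almost surely exceeds all thresholds `q j` exceeded by some member
of the family. -/
theorem exists_seq_ae_exceeds {κ T : Type*} [LinearOrder T] [TopologicalSpace T]
    [OrderTopology T] [SecondCountableTopology T] [MeasurableSpace T] [BorelSpace T]
    (P : Measure Ω) [IsProbabilityMeasure P] {S : Set κ} (hS : S.Nonempty) (X : κ → Ω → T)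
    (hX : ∀ k ∈ S, Measurable (X k)) (q : ℕ → T) :
    ∃ s : ℕ → κ, (∀ n, s n ∈ S) ∧
      ∀ k ∈ S, ∀ᵐ ω ∂P, ∀ j, q j < X k ω → ∃ n, q j < X (s n) ω := by
  have h := fun j => exists_seq_union_ae_contains P hS (fun k => {ω | q j < X k ω})
    (fun k hk => measurableSet_lt measurable_const (hX k hk))
  choose s hsS hs using h
  refine ⟨fun n => s n.unpair.1 n.unpair.2, fun n => hsS _ _, fun k hk => ?_⟩
  filter_upwards [ae_all_iff.2 fun j => hs j k hk] with ω hω j hj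
  obtain ⟨n, hn⟩ := hω j hj
  exact ⟨Nat.pair j n, by simpa using hn⟩

/-- The supremum of a countable subfamily that exceeds every rational threshold exceeded by some
member. The bound `H` keeps this real supremum from taking its default value, except on a null set.
-/
theorem exists_isEssSup {κ : Type*} (P : Measure Ω) [IsProbabilityMeasure P]
    {S : Set κ} (hS : S.Nonempty) (X : κ → Ω → ℝ) (hX : ∀ k ∈ S, Measurable (X k))
    (H : Ω → ℝ) (hH : ∀ k ∈ S, X k ≤ᵐ[P] H) : ∃ g, IsEssSup P S X g := by
  obtain ⟨q, hq⟩ := exists_surjective_nat ℚ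
  obtain ⟨s, hsS, hs⟩ := exists_seq_ae_exceeds P hS X hX (fun j => (q j : ℝ))
  have hbdd : ∀ᵐ ω ∂P, BddAbove (Set.range fun n => X (s n) ω) := by
    filter_upwards [ae_all_iff.2 fun n => hH _ (hsS n)] with ω hω
    exact ⟨H ω, by rintro _ ⟨n, rfl⟩; exact hω n⟩
  refine ⟨fun ω => ⨆ n, X (s n) ω, (Measurable.iSup fun n => hX _ (hsS n)).aemeasurable, ?_, ?_⟩
  · intro k hk
    filter_upwards [hs k hk, hbdd] with ω hω hb
    by_contra hlt
    obtain ⟨r, hr1, hr2⟩ := exists_rat_btwn (not_le.1 hlt)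
    obtain ⟨j, rfl⟩ := hq r
    obtain ⟨n, hn⟩ := hω j hr2
    exact absurd (hr1.trans hn) (not_lt.2 (le_ciSup hb n))
  · intro h _ hle
    filter_upwards [ae_all_iff.2 fun n => hle _ (hsS n)] with ω hω
    exact ciSup_le hω

theorem isEssSup_essSupOf {κ : Type*} {P : Measure Ω} {S : Set κ} {X : κ → Ω → ℝ}
    (h : ∃ g, IsEssSup P S X g) : IsEssSup P S X (essSupOf P S X) := by
  rw [essSupOf, dif_pos h]
  exact h.choose_spec

/-! ### Stopping times -/

section StoppingTimes

variable {𝓕 : Filtration ℝ≥0 mΩ} {P : Measure Ω}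

theorem mem_notBefore {ϑ τ : StoppingTime 𝓕} :
    τ ∈ notBefore P ϑ ↔ ∀ᵐ ω ∂P, ϑ.time ω ≤ τ.time ω :=
  Iff.rfl

theorem StoppingTime.measurable (τ : StoppingTime 𝓕) : Measurable τ.time :=
  τ.isStoppingTime.measurable'

theorem StoppingTime.sigma_le (τ : StoppingTime 𝓕) : τ.sigma ≤ mΩ :=
  τ.isStoppingTime.measurableSpace_le

/-- The later of two stopping times. -/
def StoppingTime.max (σ τ : StoppingTime 𝓕) : StoppingTime 𝓕 :=
  ⟨fun ω => Max.max (σ.time ω) (τ.time ω), σ.isStoppingTime.max τ.isStoppingTime⟩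

/-- The earlier of two stopping times. -/
def StoppingTime.min (σ τ : StoppingTime 𝓕) : StoppingTime 𝓕 :=
  ⟨fun ω => Min.min (σ.time ω) (τ.time ω), σ.isStoppingTime.min τ.isStoppingTime⟩

/-- The latest of the first `n + 1` members of a sequence of stopping times. -/
def StoppingTime.partialMax (σ : ℕ → StoppingTime 𝓕) : ℕ → StoppingTime 𝓕
  | 0 => σ 0
  | n + 1 => (StoppingTime.partialMax σ n).max (σ (n + 1))

/-- The supremum of a sequence of stopping times. -/
def StoppingTime.iSup (σ : ℕ → StoppingTime 𝓕) : StoppingTime 𝓕 where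
  time ω := ⨆ n, (σ n).time ω
  isStoppingTime i := by
    simp_rw [iSup_le_iff, Set.ofPred_forall]
    exact MeasurableSet.iInter fun n => (σ n).isStoppingTime i

/-- The infimum of a sequence of stopping times. -/
def StoppingTime.iInf (h𝓕 : UsualConditions 𝓕 P) (σ : ℕ → StoppingTime 𝓕) : StoppingTime 𝓕 where
  time ω := ⨅ n, (σ n).time ω
  isStoppingTime := by
    have := h𝓕.rightContinuous
    exact IsStoppingTime.iInf fun n => (σ n).isStoppingTime

theorem StoppingTime.le_partialMax (σ : ℕ → StoppingTime 𝓕) {k n : ℕ} (h : k ≤ n) (ω : Ω) :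
    (σ k).time ω ≤ (StoppingTime.partialMax σ n).time ω := by
  induction n with
  | zero => rw [Nat.le_zero.1 h]; exact le_rfl
  | succ n ih =>
    rcases Nat.le_succ_iff.1 h with h | rfl
    · exact (ih h).trans (le_max_left _ _)
    · exact le_max_right _ _

theorem StoppingTime.partialMax_le_iSup (σ : ℕ → StoppingTime 𝓕) (n : ℕ) (ω : Ω) :
    (StoppingTime.partialMax σ n).time ω ≤ (StoppingTime.iSup σ).time ω := by
  induction n with
  | zero => exact le_iSup (fun n => (σ n).time ω) 0
  | succ n ih => exact max_le ih (le_iSup (fun n => (σ n).time ω) (n + 1))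

theorem UsualConditions.measurableSet_of_ae_eq (h𝓕 : UsualConditions 𝓕 P) {t : ℝ≥0}
    {s s' : Set Ω} (hs : MeasurableSet[𝓕 t] s) (h : ∀ᵐ ω ∂P, ω ∈ s' ↔ ω ∈ s) :
    MeasurableSet[𝓕 t] s' := by
  have hnull : ∀ u : Set Ω, P u = 0 → MeasurableSet[𝓕 t] u := fun u hu =>
    𝓕.mono (zero_le) u (h𝓕.complete u hu)
  have h1 : P (s \ s') = 0 := by
    rw [measure_eq_zero_iff_ae_notMem]
    filter_upwards [h] with ω hω hm
    exact hm.2 (hω.2 hm.1)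
  have h2 : P (s' \ s) = 0 := by
    rw [measure_eq_zero_iff_ae_notMem]
    filter_upwards [h] with ω hω hm
    exact hm.2 (hω.1 hm.1)
  have : s' = (s \ (s \ s')) ∪ (s' \ s) := by
    ext ω
    by_cases a : ω ∈ s <;> by_cases b : ω ∈ s' <;> simp [a, b]
  rw [this]
  exact (hs.diff (hnull _ h1)).union (hnull _ h2)

/-- The order holds only almost surely, so completeness of the filtration is what repairs the
exceptional null set. -/
theorem sigma_mono (h𝓕 : UsualConditions 𝓕 P) {σ τ : StoppingTime 𝓕} (h : τ ∈ notBefore P σ) :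
    σ.sigma ≤ τ.sigma := by
  refine fun s hs => ⟨hs.1, fun t => ?_⟩
  refine h𝓕.measurableSet_of_ae_eq ((hs.2 t).inter (τ.isStoppingTime t)) ?_
  filter_upwards [h] with ω hω
  constructor
  · rintro ⟨h1, h2⟩
    exact ⟨⟨h1, hω.trans h2⟩, h2⟩
  · rintro ⟨⟨h1, _⟩, h2⟩
    exact ⟨h1, h2⟩

/-- Two stopping times after `κ` can be glued along an event known at `κ`. -/
theorem exists_glue (h𝓕 : UsualConditions 𝓕 P) {κ a b : StoppingTime 𝓕} {A : Set Ω}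
    (hA : MeasurableSet[κ.sigma] A) (ha : a ∈ notBefore P κ) (hb : b ∈ notBefore P κ) :
    ∃ c : StoppingTime 𝓕, (∀ ω ∈ A, c.time ω = a.time ω) ∧ ∀ ω ∉ A, c.time ω = b.time ω := by
  classical
  refine ⟨⟨A.piecewise a.time b.time, fun t => ?_⟩, fun ω h => by simp [h], fun ω h => by simp [h]⟩
  have hA' := sigma_mono h𝓕 ha A hA
  have hB' := sigma_mono h𝓕 hb Aᶜ hA.compl
  have : {ω | A.piecewise a.time b.time ω ≤ t} =
      (A ∩ {ω | a.time ω ≤ t}) ∪ (Aᶜ ∩ {ω | b.time ω ≤ t}) := by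
    ext ω
    by_cases h : ω ∈ A <;> simp [h]
  rw [this]
  exact (hA'.2 t).union (hB'.2 t)

theorem glue_mem_notBefore {κ a b c : StoppingTime 𝓕} {A : Set Ω} (ha : a ∈ notBefore P κ)
    (hb : b ∈ notBefore P κ) (hcA : ∀ ω ∈ A, c.time ω = a.time ω)
    (hcA' : ∀ ω ∉ A, c.time ω = b.time ω) : c ∈ notBefore P κ := by
  rw [mem_notBefore] at *
  filter_upwards [ha, hb] with ω h1 h2
  by_cases h : ω ∈ A
  · rw [hcA ω h]; exact h1
  · rw [hcA' ω h]; exact h2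

theorem self_mem_notBefore (τ : StoppingTime 𝓕) : τ ∈ notBefore P τ :=
  mem_notBefore.2 <| Eventually.of_forall fun _ => le_rfl

theorem notBefore_trans {ρ σ τ : StoppingTime 𝓕} (h1 : σ ∈ notBefore P ρ)
    (h2 : τ ∈ notBefore P σ) : τ ∈ notBefore P ρ := by
  rw [mem_notBefore] at *
  filter_upwards [h1, h2] with ω a b using a.trans b

theorem left_mem_notBefore_min (σ τ : StoppingTime 𝓕) : σ ∈ notBefore P (σ.min τ) :=
  mem_notBefore.2 <| Eventually.of_forall fun _ => min_le_left _ _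

theorem right_mem_notBefore_min (σ τ : StoppingTime 𝓕) : τ ∈ notBefore P (σ.min τ) :=
  mem_notBefore.2 <| Eventually.of_forall fun _ => min_le_right _ _

theorem measurableSet_time_le_time (σ τ : StoppingTime 𝓕) :
    MeasurableSet[(σ.min τ).sigma] {ω | σ.time ω ≤ τ.time ω} :=
  σ.isStoppingTime.measurableSet_stopping_time_le_min τ.isStoppingTime

theorem condExp_eq_on {m : MeasurableSpace Ω} {A : Set Ω} (hA : MeasurableSet[m] A)
    {f g : Ω → ℝ} (hf : Integrable f P) (hg : Integrable g P)
    (h : ∀ᵐ ω ∂P, ω ∈ A → f ω = g ω) : ∀ᵐ ω ∂P, ω ∈ A → (P[f | m]) ω = (P[g | m]) ω := by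
  have h2 : A.indicator f =ᵐ[P] A.indicator g := by
    filter_upwards [h] with ω hω
    by_cases hm : ω ∈ A
    · simp [hm, hω hm]
    · simp [hm]
  filter_upwards [condExp_indicator hf hA, condExp_indicator hg hA,
    condExp_congr_ae (m := m) h2] with ω b c d hω
  rw [b, c] at d
  simpa [hω] using d

variable [IsProbabilityMeasure P]

/-- Conditional expectations at two stopping times agree where the stopping times do. -/
theorem condExp_eq_on_eq (σ τ : StoppingTime 𝓕) {f g : Ω → ℝ} (hf : Integrable f P)
    (hg : Integrable g P) (h : ∀ᵐ ω ∂P, σ.time ω = τ.time ω → f ω = g ω) :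
    ∀ᵐ ω ∂P, σ.time ω = τ.time ω → (P[f | σ.sigma]) ω = (P[g | τ.sigma]) ω := by
  have hE : MeasurableSet {ω | σ.time ω = τ.time ω} := measurableSet_eq_fun σ.measurable τ.measurable
  have hEσ : MeasurableSet[σ.sigma] {ω | σ.time ω = τ.time ω} :=
    σ.isStoppingTime.measurableSet_eq_stopping_time τ.isStoppingTime
  have hEmin : MeasurableSet[(σ.min τ).sigma] {ω | σ.time ω = τ.time ω} :=
    σ.isStoppingTime.measurableSet_eq_stopping_time_min τ.isStoppingTime
  -- On `{σ = τ}` both σ-algebras have the same trace as the σ-algebra of `min σ τ`, which makes the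
  -- two conditional expectations agree there.
  have hsub : ∀ s : Set Ω, MeasurableSet[σ.sigma] ({ω | σ.time ω = τ.time ω} ∩ s) →
      MeasurableSet[(σ.min τ).sigma] ({ω | σ.time ω = τ.time ω} ∩ s) := by
    intro s hs
    have := σ.isStoppingTime.measurableSet_inter_le τ.isStoppingTime _ hs
    have heq : {ω | σ.time ω = τ.time ω} ∩ s =
        {ω | σ.time ω = τ.time ω} ∩ s ∩ {ω | σ.time ω ≤ τ.time ω} := by
      symm
      apply Set.inter_eq_left.2
      rintro ω ⟨h, -⟩
      exact le_of_eq h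
    rw [heq]
    exact this
  have hsub' : ∀ s : Set Ω, MeasurableSet[τ.sigma] ({ω | σ.time ω = τ.time ω} ∩ s) →
      MeasurableSet[(σ.min τ).sigma] ({ω | σ.time ω = τ.time ω} ∩ s) := by
    intro s hs
    have := τ.isStoppingTime.measurableSet_inter_le σ.isStoppingTime _ hs
    have hcomm : (τ.isStoppingTime.min σ.isStoppingTime).measurableSpace = (σ.min τ).sigma := by
      rw [IsStoppingTime.measurableSpace_min τ.isStoppingTime σ.isStoppingTime, inf_comm,
        ← IsStoppingTime.measurableSpace_min σ.isStoppingTime τ.isStoppingTime]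
      rfl
    rw [hcomm] at this
    have heq : {ω | σ.time ω = τ.time ω} ∩ s =
        {ω | σ.time ω = τ.time ω} ∩ s ∩ {ω | τ.time ω ≤ σ.time ω} := by
      symm
      apply Set.inter_eq_left.2
      rintro ω ⟨h, -⟩
      exact ge_of_eq h
    rw [heq]
    exact this
  have h1 : P[f | σ.sigma] =ᵐ[P.restrict {ω | σ.time ω = τ.time ω}] P[f | τ.sigma] := by
    refine condExp_ae_eq_restrict_of_measurableSpace_eq_on σ.sigma_le τ.sigma_le hEσ fun s => ?_
    constructor
    · intro hs
      exact ((σ.isStoppingTime.measurableSet_min_iff τ.isStoppingTime _).1 (hsub s hs)).2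
    · intro hs
      exact ((σ.isStoppingTime.measurableSet_min_iff τ.isStoppingTime _).1 (hsub' s hs)).1
  have hEτ : MeasurableSet[τ.sigma] {ω | σ.time ω = τ.time ω} :=
    ((σ.isStoppingTime.measurableSet_min_iff τ.isStoppingTime _).1 hEmin).2
  filter_upwards [(ae_restrict_iff' hE).1 h1, condExp_eq_on hEτ hf hg h] with ω a b hω
  rw [a hω, b hω]

end StoppingTimes

/-! ### Optimal stopping of an accrued stream -/

section Gain

variable {𝓕 : Filtration ℝ≥0 mΩ} {P : Measure Ω}

theorem measurable_timeZero : Measurable (timeZero : Ω → WithTop ℝ≥0) := measurable_const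

theorem measurable_timeInfty : Measurable (timeInfty : Ω → WithTop ℝ≥0) := measurable_const

theorem timeZero_le (a : WithTop ℝ≥0) (ω : Ω) : timeZero ω ≤ a := bot_le

theorem le_timeInfty (a : WithTop ℝ≥0) (ω : Ω) : a ≤ timeInfty ω := le_top

/-- The expected revenue accrued up to a stopping time. -/
def gain (P : Measure Ω) (y : Ω × ℝ≥0 → ℝ) (σ : StoppingTime 𝓕) : ℝ :=
  ∫ ω, accrued y timeZero σ.time ω ∂P

/-- `a` maximizes the expected accrued revenue among the stopping times after `τ`, and no
maximizer is later with positive probability. -/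
structure IsLatestMax (P : Measure Ω) (y : Ω × ℝ≥0 → ℝ) (τ a : StoppingTime 𝓕) : Prop where
  mem : a ∈ notBefore P τ
  isMax : ∀ c ∈ notBefore P τ, gain P y c ≤ gain P y a
  latest : ∀ c ∈ notBefore P τ, gain P y a ≤ gain P y c → ∀ᵐ ω ∂P, c.time ω ≤ a.time ω

theorem gain_congr {y : Ω × ℝ≥0 → ℝ} {a b : StoppingTime 𝓕} (h : ∀ᵐ ω ∂P, a.time ω = b.time ω) :
    gain P y a = gain P y b :=
  integral_congr_ae <| h.mono fun _ hω => accrued_congr rfl hω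

/-- The graph of a stopping time is a null set because `dt` has no atoms. Limits of accrual windows
therefore need no control at the limiting date. -/
theorem ae_prod_ne_time (τ : StoppingTime 𝓕) :
    ∀ᵐ p : Ω × ℝ≥0 ∂(P.prod timeMeasure), (p.2 : WithTop ℝ≥0) ≠ τ.time p.1 := by
  have hm : MeasurableSet {p : Ω × ℝ≥0 | (p.2 : WithTop ℝ≥0) = τ.time p.1} :=
    measurableSet_eq_fun (WithTop.measurable_coe.comp measurable_snd)
      (τ.measurable.comp measurable_fst)
  have h0 : (P.prod timeMeasure) {p : Ω × ℝ≥0 | (p.2 : WithTop ℝ≥0) = τ.time p.1} = 0 := by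
    rw [Measure.measure_prod_null hm]
    refine Eventually.of_forall fun ω => ?_
    refine Set.Subsingleton.measure_zero ?_ _
    intro s hs t ht
    exact WithTop.coe_injective (Eq.trans hs (Eq.symm ht))
  exact measure_eq_zero_iff_ae_notMem.1 h0

theorem min_mem_notBefore {τ a b : StoppingTime 𝓕} (ha : a ∈ notBefore P τ)
    (hb : b ∈ notBefore P τ) : a.min b ∈ notBefore P τ := by
  rw [mem_notBefore] at *
  filter_upwards [ha, hb] with ω h1 h2 using le_min h1 h2

theorem max_mem_notBefore {τ a : StoppingTime 𝓕} (ha : a ∈ notBefore P τ)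
    (b : StoppingTime 𝓕) : a.max b ∈ notBefore P τ := by
  rw [mem_notBefore] at *
  filter_upwards [ha] with ω h1 using h1.trans (le_max_left _ _)

theorem partialMax_mem_notBefore {τ : StoppingTime 𝓕} {σ : ℕ → StoppingTime 𝓕}
    (hσ : ∀ n, σ n ∈ notBefore P τ) (n : ℕ) : StoppingTime.partialMax σ n ∈ notBefore P τ := by
  induction n with
  | zero => exact hσ 0
  | succ n ih => exact max_mem_notBefore ih _

theorem iSup_mem_notBefore {τ : StoppingTime 𝓕} {σ : ℕ → StoppingTime 𝓕}
    (hσ : ∀ n, σ n ∈ notBefore P τ) : StoppingTime.iSup σ ∈ notBefore P τ := by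
  have h := hσ 0
  rw [mem_notBefore] at *
  filter_upwards [h] with ω hω
  exact hω.trans (le_iSup (fun n => (σ n).time ω) 0)

theorem IsLatestMax.congr {y : Ω × ℝ≥0 → ℝ} {τ a b : StoppingTime 𝓕} (ha : IsLatestMax P y τ a)
    (h : ∀ᵐ ω ∂P, a.time ω = b.time ω) : IsLatestMax P y τ b where
  mem := by
    filter_upwards [mem_notBefore.1 ha.mem, h] with ω h1 h2
    rwa [← h2]
  isMax c hc := by rw [← gain_congr h]; exact ha.isMax c hc
  latest c hc hle := by
    rw [← gain_congr h] at hle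
    filter_upwards [ha.latest c hc hle, h] with ω h1 h2
    rwa [← h2]

variable [IsProbabilityMeasure P] {y : Ω × ℝ≥0 → ℝ}

theorem integrable_accrued_stoppingTime (hy : Integrable y (P.prod timeMeasure))
    (σ : StoppingTime 𝓕) : Integrable (accrued y timeZero σ.time) P :=
  integrable_accrued hy measurable_timeZero σ.measurable

theorem gain_eq_integral_indicator (hy : Integrable y (P.prod timeMeasure))
    (σ : StoppingTime 𝓕) :
    gain P y σ = ∫ p, {p : Ω × ℝ≥0 | timeZero p.1 ≤ (p.2 : WithTop ℝ≥0) ∧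
      (p.2 : WithTop ℝ≥0) < σ.time p.1}.indicator y p ∂(P.prod timeMeasure) := by
  rw [integral_prod _
    (hy.indicator (measurableSet_accrualWindow measurable_timeZero σ.measurable)), gain]
  exact integral_congr_ae (Eventually.of_forall fun ω => accrued_eq_integral_indicator _ _ _ _)

theorem gain_le_integral_abs (hy : Integrable y (P.prod timeMeasure)) (σ : StoppingTime 𝓕) :
    gain P y σ ≤ ∫ p, |y p| ∂(P.prod timeMeasure) := by
  rw [gain_eq_integral_indicator hy]
  refine integral_mono
    (hy.indicator (measurableSet_accrualWindow measurable_timeZero σ.measurable)) hy.abs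
    fun p => ?_
  refine (le_abs_self _).trans ?_
  simpa [Real.norm_eq_abs] using norm_indicator_le_norm_self (s := {p : Ω × ℝ≥0 |
    timeZero p.1 ≤ (p.2 : WithTop ℝ≥0) ∧ (p.2 : WithTop ℝ≥0) < σ.time p.1}) y p

/-- Exchanging two stopping times pathwise preserves the sum of their gains. -/
theorem gain_add_gain_of_swap (hy : Integrable y (P.prod timeMeasure))
    {a b c d : StoppingTime 𝓕}
    (h : ∀ᵐ ω ∂P, (c.time ω = a.time ω ∧ d.time ω = b.time ω) ∨
      (c.time ω = b.time ω ∧ d.time ω = a.time ω)) :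
    gain P y c + gain P y d = gain P y a + gain P y b := by
  have hi := fun σ : StoppingTime 𝓕 => integrable_accrued_stoppingTime hy σ
  rw [gain, gain, gain, gain, ← integral_add (hi c) (hi d), ← integral_add (hi a) (hi b)]
  refine integral_congr_ae ?_
  filter_upwards [h] with ω hω
  rcases hω with ⟨h1, h2⟩ | ⟨h1, h2⟩
  · rw [accrued_congr (rfl : timeZero ω = timeZero ω) h1,
      accrued_congr (rfl : timeZero ω = timeZero ω) h2]
  · rw [accrued_congr (rfl : timeZero ω = timeZero ω) h1,
      accrued_congr (rfl : timeZero ω = timeZero ω) h2, add_comm]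

theorem tendsto_gain (hy : Integrable y (P.prod timeMeasure)) {σ : ℕ → StoppingTime 𝓕}
    {τ : StoppingTime 𝓕} (h : ∀ ω (s : ℝ≥0), (s : WithTop ℝ≥0) ≠ τ.time ω →
      ∀ᶠ n in atTop, ((s : WithTop ℝ≥0) < (σ n).time ω ↔ (s : WithTop ℝ≥0) < τ.time ω)) :
    Tendsto (fun n => gain P y (σ n)) atTop (𝓝 (gain P y τ)) := by
  simp_rw [gain_eq_integral_indicator hy]
  refine tendsto_integral_of_dominated_convergence (fun p => ‖y p‖) (fun n => ?_) hy.norm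
    (fun n => Eventually.of_forall fun p => norm_indicator_le_norm_self _ _) ?_
  · exact (hy.indicator (measurableSet_accrualWindow measurable_timeZero
      (σ n).measurable)).aestronglyMeasurable
  · filter_upwards [ae_prod_ne_time τ] with p hp
    refine tendsto_const_nhds.congr' ?_
    filter_upwards [h p.1 p.2 hp] with n hn
    simp only [Set.indicator, Set.mem_ofPred_eq, hn]
    congr

theorem tendsto_gain_partialMax (hy : Integrable y (P.prod timeMeasure))
    (σ : ℕ → StoppingTime 𝓕) :
    Tendsto (fun n => gain P y (StoppingTime.partialMax σ n)) atTop
      (𝓝 (gain P y (StoppingTime.iSup σ))) := by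
  refine tendsto_gain hy fun ω s _ => ?_
  by_cases hs : (s : WithTop ℝ≥0) < (StoppingTime.iSup σ).time ω
  · obtain ⟨k, hk⟩ := lt_iSup_iff.1 hs
    filter_upwards [eventually_ge_atTop k] with n hn
    exact iff_of_true (hk.trans_le (StoppingTime.le_partialMax σ hn ω)) hs
  · refine Eventually.of_forall fun n => iff_of_false (fun h => hs ?_) hs
    exact h.trans_le (StoppingTime.partialMax_le_iSup σ n ω)

theorem tendsto_gain_iInf (h𝓕 : UsualConditions 𝓕 P) (hy : Integrable y (P.prod timeMeasure))
    {σ : ℕ → StoppingTime 𝓕} (hσ : ∀ ω, Antitone fun n => (σ n).time ω) :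
    Tendsto (fun n => gain P y (σ n)) atTop (𝓝 (gain P y (StoppingTime.iInf h𝓕 σ))) := by
  refine tendsto_gain hy fun ω s hne => ?_
  rcases lt_or_gt_of_ne hne with hs | hs
  · exact Eventually.of_forall fun n =>
      iff_of_true (hs.trans_le (iInf_le (fun n => (σ n).time ω) n)) hs
  · obtain ⟨k, hk⟩ := iInf_lt_iff.1 hs
    filter_upwards [eventually_ge_atTop k] with n hn
    exact iff_of_false (not_lt.2 ((hσ ω hn).trans hk.le)) (not_lt.2 hs.le)

theorem gain_max_add_gain_min (hy : Integrable y (P.prod timeMeasure)) (a b : StoppingTime 𝓕) :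
    gain P y (a.max b) + gain P y (a.min b) = gain P y a + gain P y b := by
  refine gain_add_gain_of_swap hy (Eventually.of_forall fun ω => ?_)
  rcases le_total (a.time ω) (b.time ω) with h | h
  · exact Or.inr ⟨max_eq_right h, min_eq_left h⟩
  · exact Or.inl ⟨max_eq_left h, min_eq_right h⟩

/-- By modularity, the shortfalls from an upper bound `V` at most add up when two stopping times are
replaced by their maximum. -/
theorem gain_max_ge (hy : Integrable y (P.prod timeMeasure)) {τ a b : StoppingTime 𝓕} {V : ℝ}
    (hV : ∀ c ∈ notBefore P τ, gain P y c ≤ V) (ha : a ∈ notBefore P τ)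
    (hb : b ∈ notBefore P τ) : gain P y a + gain P y b - V ≤ gain P y (a.max b) := by
  have h1 := gain_max_add_gain_min hy a b
  have h2 := hV _ (min_mem_notBefore ha hb)
  linarith

/-- The limit superior of stopping times with summable shortfalls is optimal, because `gain` passes
to increasing and then to decreasing limits. -/
theorem exists_max_gain (h𝓕 : UsualConditions 𝓕 P) (hy : Integrable y (P.prod timeMeasure))
    (τ : StoppingTime 𝓕) :
    ∃ a ∈ notBefore P τ, ∀ c ∈ notBefore P τ, gain P y c ≤ gain P y a := by
  have hbdd : BddAbove (gain P y '' notBefore P τ) :=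
    ⟨_, by rintro _ ⟨c, -, rfl⟩; exact gain_le_integral_abs hy c⟩
  have hne : (gain P y '' notBefore P τ).Nonempty :=
    ⟨_, τ, self_mem_notBefore τ, rfl⟩
  set V := sSup (gain P y '' notBefore P τ) with hVdef
  have hV : ∀ c ∈ notBefore P τ, gain P y c ≤ V := fun c hc => le_csSup hbdd ⟨c, hc, rfl⟩
  have hex : ∀ n : ℕ, ∃ c ∈ notBefore P τ, V - (1 / 2 : ℝ) ^ n ≤ gain P y c := by
    intro n
    obtain ⟨_, ⟨c, hc, rfl⟩, h⟩ := exists_lt_of_lt_csSup hne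
      (show V - (1 / 2 : ℝ) ^ n < V by have : (0 : ℝ) < (1 / 2) ^ n := by positivity
                                       linarith)
    exact ⟨c, hc, h.le⟩
  choose σ hσ hσV using hex
  -- The shortfalls `(1/2)^n, …, (1/2)^(n+m)` sum to `2 * (1/2)^n - (1/2)^(n+m)`.
  have hpart : ∀ n m : ℕ, V - 2 * (1 / 2 : ℝ) ^ n + (1 / 2 : ℝ) ^ (n + m) ≤
      gain P y (StoppingTime.partialMax (fun k => σ (n + k)) m) := by
    intro n m
    induction m with
    | zero =>
      have := hσV n
      simp only [add_zero, StoppingTime.partialMax]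
      linarith
    | succ m ih =>
      have h1 := gain_max_ge hy hV
        (partialMax_mem_notBefore (fun k => hσ (n + k)) m) (hσ (n + (m + 1)))
      have h2 := hσV (n + (m + 1))
      have h3 : (1 / 2 : ℝ) ^ (n + m) = 2 * (1 / 2) ^ (n + (m + 1)) := by
        rw [← add_assoc, pow_succ]; ring
      simp only [StoppingTime.partialMax]
      linarith
  have hsup : ∀ n : ℕ, V - 2 * (1 / 2 : ℝ) ^ n ≤
      gain P y (StoppingTime.iSup fun k => σ (n + k)) := by
    intro n
    refine ge_of_tendsto' (tendsto_gain_partialMax hy _) fun m => ?_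
    have h1 := hpart n m
    have h2 : (0 : ℝ) < (1 / 2) ^ (n + m) := by positivity
    linarith
  have hanti : ∀ ω, Antitone fun n => (StoppingTime.iSup fun k => σ (n + k)).time ω := by
    intro ω
    refine antitone_nat_of_succ_le fun n => ?_
    refine iSup_le fun k => ?_
    have : σ (n + 1 + k) = σ (n + (k + 1)) := by congr 1; ring
    beta_reduce
    rw [this]
    exact le_iSup (fun k => (σ (n + k)).time ω) (k + 1)
  refine ⟨StoppingTime.iInf h𝓕 fun n => StoppingTime.iSup fun k => σ (n + k), ?_, ?_⟩
  · have h := ae_all_iff.2 fun n => mem_notBefore.1 (hσ n)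
    rw [mem_notBefore]
    filter_upwards [h] with ω hω
    exact le_iInf fun n => (hω n).trans (le_iSup (fun k => (σ (n + k)).time ω) 0)
  · intro c hc
    refine (hV c hc).trans ?_
    have hlim : Tendsto (fun n : ℕ => V - 2 * (1 / 2 : ℝ) ^ n) atTop (𝓝 V) := by
      have := (tendsto_pow_atTop_nhds_zero_of_lt_one (r := (1 / 2 : ℝ)) (by norm_num)
        (by norm_num)).const_mul 2
      simpa using tendsto_const_nhds.sub this
    exact le_of_tendsto_of_tendsto' hlim (tendsto_gain_iInf h𝓕 hy hanti) hsup

/-- Maximizers are closed under pairwise maxima and, by continuity of `gain`, under countable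
suprema. A countable family passing every threshold of a dense sequence passed by some maximizer
suffices, so its supremum is the latest maximizer. -/
theorem exists_isLatestMax (h𝓕 : UsualConditions 𝓕 P) (hy : Integrable y (P.prod timeMeasure))
    (τ : StoppingTime 𝓕) : ∃ a, IsLatestMax P y τ a := by
  obtain ⟨a₀, ha₀, hmax⟩ := exists_max_gain h𝓕 hy τ
  let S : Set (StoppingTime 𝓕) := {a | a ∈ notBefore P τ ∧ gain P y a₀ ≤ gain P y a}
  obtain ⟨s, hsS, hs⟩ := exists_seq_ae_exceeds P (S := S) ⟨a₀, ha₀, le_rfl⟩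
    (fun a => a.time) (fun a _ => a.measurable) (TopologicalSpace.denseSeq (WithTop ℝ≥0))
  have hpart : ∀ n, gain P y a₀ ≤ gain P y (StoppingTime.partialMax s n) := by
    intro n
    induction n with
    | zero => exact (hsS 0).2
    | succ n ih =>
      have h1 := gain_max_ge hy hmax (partialMax_mem_notBefore (fun k => (hsS k).1) n)
        (hsS (n + 1)).1
      have h2 := (hsS (n + 1)).2
      simp only [StoppingTime.partialMax]
      linarith
  have hsup : gain P y a₀ ≤ gain P y (StoppingTime.iSup s) :=
    ge_of_tendsto' (tendsto_gain_partialMax hy s) hpart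
  refine ⟨StoppingTime.iSup s, iSup_mem_notBefore fun n => (hsS n).1,
    fun c hc => (hmax c hc).trans hsup, fun c hc hle => ?_⟩
  filter_upwards [hs c ⟨hc, hsup.trans hle⟩] with ω hω
  by_contra hlt
  obtain ⟨_, ⟨j, rfl⟩, h1, h2⟩ :=
    (TopologicalSpace.denseRange_denseSeq (WithTop ℝ≥0)).exists_between (not_le.1 hlt)
  obtain ⟨n, hn⟩ := hω j h2
  exact absurd (h1.trans hn) (not_lt.2 (le_iSup (fun n => (s n).time ω) n))

/-- Where one starting date precedes another, so do the latest optimal stopping times. -/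
theorem IsLatestMax.le_of_le (h𝓕 : UsualConditions 𝓕 P) (hy : Integrable y (P.prod timeMeasure))
    {σ ρ a b : StoppingTime 𝓕} (ha : IsLatestMax P y σ a) (hb : IsLatestMax P y ρ b) :
    ∀ᵐ ω ∂P, σ.time ω ≤ ρ.time ω → a.time ω ≤ b.time ω := by
  have hA := measurableSet_time_le_time σ ρ
  have ham : a ∈ notBefore P (σ.min ρ) := notBefore_trans (left_mem_notBefore_min σ ρ) ha.mem
  have hbm : b ∈ notBefore P (σ.min ρ) := notBefore_trans (right_mem_notBefore_min σ ρ) hb.mem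
  -- Exchange argument: on `{σ ≤ ρ}` take `c = max a b` and `d = min a b`; elsewhere `c = b` and `d
  -- = a`. Then `c` is feasible after `ρ`, `d` is feasible after `σ`, and the total gain is
  -- unchanged. Since `d` cannot beat `a`, `c` is as good as `b`, hence not later than `b`.
  obtain ⟨c, hcA, hcA'⟩ := exists_glue h𝓕 hA (max_mem_notBefore ham b) hbm
  obtain ⟨d, hdA, hdA'⟩ := exists_glue h𝓕 hA (min_mem_notBefore ham hbm) ham
  have hc : c ∈ notBefore P ρ := by
    filter_upwards [mem_notBefore.1 hb.mem] with ω hω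
    by_cases h : ω ∈ {ω | σ.time ω ≤ ρ.time ω}
    · rw [hcA ω h]; exact hω.trans (le_max_right _ _)
    · rw [hcA' ω h]; exact hω
  have hd : d ∈ notBefore P σ := by
    filter_upwards [mem_notBefore.1 ha.mem, mem_notBefore.1 hb.mem] with ω h1 h2
    by_cases h : ω ∈ {ω | σ.time ω ≤ ρ.time ω}
    · rw [hdA ω h]; exact le_min h1 (le_trans h h2)
    · rw [hdA' ω h]; exact h1
  have hsum : gain P y c + gain P y d = gain P y a + gain P y b := by
    refine gain_add_gain_of_swap hy (Eventually.of_forall fun ω => ?_)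
    by_cases h : ω ∈ {ω | σ.time ω ≤ ρ.time ω}
    · rw [hcA ω h, hdA ω h]
      rcases le_total (a.time ω) (b.time ω) with h | h
      · exact Or.inr ⟨max_eq_right h, min_eq_left h⟩
      · exact Or.inl ⟨max_eq_left h, min_eq_right h⟩
    · exact Or.inr ⟨hcA' ω h, hdA' ω h⟩
  have hle := ha.isMax d hd
  filter_upwards [hb.latest c hc (by linarith)] with ω hω h
  rw [hcA ω h] at hω
  exact (le_max_left _ _).trans hω

end Gain

/-! ### Values of stopping problems -/

section Value

variable {𝓕 : Filtration ℝ≥0 mΩ} {P : Measure Ω}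

theorem measurable_condExp_sigma (ϑ : StoppingTime 𝓕) (f : Ω → ℝ) :
    Measurable (P[f | ϑ.sigma]) :=
  (stronglyMeasurable_condExp.mono ϑ.sigma_le).measurable

theorem stopValue_ae_eq {ϑ a : StoppingTime 𝓕} {X : StoppingTime 𝓕 → Ω → ℝ}
    (ha : a ∈ notBefore P ϑ)
    (h : ∀ c ∈ notBefore P ϑ, P[X c | ϑ.sigma] ≤ᵐ[P] P[X a | ϑ.sigma]) :
    stopValue P ϑ X =ᵐ[P] P[X a | ϑ.sigma] := by
  have hm : AEMeasurable (P[X a | ϑ.sigma]) P := (measurable_condExp_sigma ϑ _).aemeasurable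
  have hg := isEssSup_essSupOf
    (⟨P[X a | ϑ.sigma], hm, h, fun _ _ hle => hle a ha⟩ :
      ∃ g, IsEssSup P (notBefore P ϑ) (fun τ => P[X τ | ϑ.sigma]) g)
  exact (hg.least _ hm h).antisymm (hg.upper a ha)

theorem attainsOn_of_forall_le {ϑ a : StoppingTime 𝓕} {X : StoppingTime 𝓕 → Ω → ℝ}
    (hX : IsEssSup P (notBefore P ϑ) (fun τ => P[X τ | ϑ.sigma]) (stopValue P ϑ X))
    (ha : a ∈ notBefore P ϑ) {C : Set Ω} (hC : MeasurableSet C)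
    (h : ∀ c ∈ notBefore P ϑ, ∀ᵐ ω ∂P, ω ∈ C →
      (P[X c | ϑ.sigma]) ω ≤ (P[X a | ϑ.sigma]) ω) :
    AttainsOn P ϑ X a C := by
  classical
  refine ⟨ha, ?_⟩
  -- Comparison is available only on `C`, so the upper bound tested against the essential supremum
  -- is patched with the value itself off `C`.
  have hm : AEMeasurable (C.piecewise (P[X a | ϑ.sigma]) (stopValue P ϑ X)) P := by
    obtain ⟨g, hg, hgX⟩ := hX.aemeasurable
    refine ⟨C.piecewise (P[X a | ϑ.sigma]) g,
      Measurable.piecewise hC (measurable_condExp_sigma ϑ _) hg, ?_⟩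
    filter_upwards [hgX] with ω hω
    by_cases h : ω ∈ C <;> simp [h, hω]
  have hle := hX.least _ hm fun c hc => by
    filter_upwards [h c hc, hX.upper c hc] with ω h1 h2
    by_cases hω : ω ∈ C
    · simpa [hω] using h1 hω
    · simpa [hω] using h2
  filter_upwards [hle, hX.upper a ha] with ω h1 h2 hω
  refine le_antisymm h2 ?_
  simpa [hω] using h1

variable [IsProbabilityMeasure P]

theorem isEssSup_stopValue (ϑ : StoppingTime 𝓕) {X : StoppingTime 𝓕 → Ω → ℝ} (H : Ω → ℝ)
    (hH : ∀ c ∈ notBefore P ϑ, P[X c | ϑ.sigma] ≤ᵐ[P] H) :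
    IsEssSup P (notBefore P ϑ) (fun τ => P[X τ | ϑ.sigma]) (stopValue P ϑ X) :=
  isEssSup_essSupOf <| exists_isEssSup P ⟨ϑ, self_mem_notBefore ϑ⟩ _
    (fun _ _ => measurable_condExp_sigma ϑ _) H hH

theorem condExp_mono_of_setIntegral_le {m : MeasurableSpace Ω} (hm : m ≤ mΩ) {f g : Ω → ℝ}
    (hf : Integrable f P) (hg : Integrable g P)
    (h : ∀ A, MeasurableSet[m] A → ∫ ω in A, f ω ∂P ≤ ∫ ω in A, g ω ∂P) :
    P[f | m] ≤ᵐ[P] P[g | m] := by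
  refine ae_le_of_ae_le_trim (hm := hm) ?_
  refine ae_le_of_forall_setIntegral_le
    (integrable_condExp.trim hm stronglyMeasurable_condExp)
    (integrable_condExp.trim hm stronglyMeasurable_condExp) fun A hA _ => ?_
  rw [← setIntegral_trim hm stronglyMeasurable_condExp hA,
    ← setIntegral_trim hm stronglyMeasurable_condExp hA, setIntegral_condExp hm hf hA,
    setIntegral_condExp hm hg hA]
  exact h A hA

variable {y : Ω × ℝ≥0 → ℝ}

theorem gain_sub_gain_of_glue (hy : Integrable y (P.prod timeMeasure)) {a c d : StoppingTime 𝓕}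
    {A : Set Ω} (hA : MeasurableSet A) (hdA : ∀ ω ∈ A, d.time ω = c.time ω)
    (hdA' : ∀ ω ∉ A, d.time ω = a.time ω) :
    gain P y d - gain P y a =
      ∫ ω in A, accrued y timeZero c.time ω ∂P - ∫ ω in A, accrued y timeZero a.time ω ∂P := by
  have hi := fun σ : StoppingTime 𝓕 => integrable_accrued_stoppingTime hy σ
  rw [gain, gain, ← integral_sub (hi d) (hi a),
    ← integral_sub (hi c).integrableOn (hi a).integrableOn, ← integral_indicator hA]
  congr 1
  ext ω
  by_cases h : ω ∈ A
  · simp only [Set.indicator_of_mem h]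
    rw [accrued_congr (rfl : timeZero ω = timeZero ω) (hdA ω h)]
  · simp only [Set.indicator_of_notMem h]
    rw [accrued_congr (rfl : timeZero ω = timeZero ω) (hdA' ω h), sub_self]

/-- Unconditional optimality localizes: switching from `a` to `c` on an event known at `τ` gives a
feasible stopping time, so it cannot raise the gain. -/
theorem IsLatestMax.condExp_le (h𝓕 : UsualConditions 𝓕 P)
    (hy : Integrable y (P.prod timeMeasure)) {τ a c : StoppingTime 𝓕}
    (ha : IsLatestMax P y τ a) (hc : c ∈ notBefore P τ) :
    P[accrued y timeZero c.time | τ.sigma] ≤ᵐ[P] P[accrued y timeZero a.time | τ.sigma] := by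
  refine condExp_mono_of_setIntegral_le τ.sigma_le (integrable_accrued_stoppingTime hy c)
    (integrable_accrued_stoppingTime hy a) fun A hA => ?_
  obtain ⟨d, hd, hd'⟩ := exists_glue h𝓕 hA hc ha.mem
  have h1 := gain_sub_gain_of_glue hy (τ.sigma_le A hA) hd hd'
  have h2 := ha.isMax d (glue_mem_notBefore hc ha.mem hd hd')
  linarith

/-- Switching to `c` exactly where the conditional values agree costs nothing, so the glued time is
a maximizer and cannot be later than `a`. -/
theorem IsLatestMax.le_of_condExp_eq (h𝓕 : UsualConditions 𝓕 P)
    (hy : Integrable y (P.prod timeMeasure)) {τ a c : StoppingTime 𝓕}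
    (ha : IsLatestMax P y τ a) (hc : c ∈ notBefore P τ) :
    ∀ᵐ ω ∂P, (P[accrued y timeZero c.time | τ.sigma]) ω
      = (P[accrued y timeZero a.time | τ.sigma]) ω → c.time ω ≤ a.time ω := by
  have hA : MeasurableSet[τ.sigma] {ω | (P[accrued y timeZero c.time | τ.sigma]) ω
      = (P[accrued y timeZero a.time | τ.sigma]) ω} :=
    StronglyMeasurable.measurableSet_eq_fun stronglyMeasurable_condExp stronglyMeasurable_condExp
  obtain ⟨d, hd, hd'⟩ := exists_glue h𝓕 hA hc ha.mem
  have h1 := gain_sub_gain_of_glue hy (τ.sigma_le _ hA) hd hd'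
  rw [← setIntegral_condExp τ.sigma_le (integrable_accrued_stoppingTime hy c) hA,
    ← setIntegral_condExp τ.sigma_le (integrable_accrued_stoppingTime hy a) hA,
    setIntegral_congr_fun (τ.sigma_le _ hA) (fun ω hω => hω), sub_self] at h1
  filter_upwards [ha.latest d (glue_mem_notBefore hc ha.mem hd hd') (by linarith)] with ω hω h
  rwa [hd ω h] at hω

end Value

/-! ### Adaptedness of accrued revenue -/

section Adapted

variable {𝓕 : Filtration ℝ≥0 mΩ} {P : Measure Ω} [IsProbabilityMeasure P]

theorem continuous_accrued {x : Ω × ℝ≥0 → ℝ} {ω : Ω}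
    (hx : Integrable (fun s => x (ω, s)) timeMeasure) :
    Continuous fun t : ℝ≥0 => accrued x timeZero (fun _ => (t : WithTop ℝ≥0)) ω := by
  simp_rw [accrued_eq_integral_indicator]
  rw [continuous_iff_continuousAt]
  intro t₀
  have hmeas : ∀ t : ℝ≥0, AEStronglyMeasurable (fun s => {p : Ω × ℝ≥0 |
      timeZero p.1 ≤ (p.2 : WithTop ℝ≥0) ∧ (p.2 : WithTop ℝ≥0) < (t : WithTop ℝ≥0)}.indicator x
        (ω, s)) timeMeasure := fun t =>
    (hx.indicator (measurableSet_timeWindow (timeZero ω) (t : WithTop ℝ≥0))).aestronglyMeasurable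
  refine continuousAt_of_dominated (bound := fun s => ‖x (ω, s)‖) (Eventually.of_forall hmeas)
    (Eventually.of_forall fun t => Eventually.of_forall fun s => norm_indicator_le_norm_self _ _)
    hx.norm ?_
  have hne : ∀ᵐ s : ℝ≥0 ∂timeMeasure, s ≠ t₀ := by
    rw [ae_iff]; simp
  filter_upwards [hne] with s hs
  have hloc : ∀ᶠ t in 𝓝 t₀, (s < t ↔ s < t₀) := by
    rcases lt_or_gt_of_ne hs with h | h
    · filter_upwards [lt_mem_nhds h] with t ht using iff_of_true ht h
    · filter_upwards [gt_mem_nhds h] with t ht using iff_of_false ht.not_gt h.not_gt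
  refine ContinuousAt.congr (f := fun _ => {p : Ω × ℝ≥0 |
      timeZero p.1 ≤ (p.2 : WithTop ℝ≥0) ∧ (p.2 : WithTop ℝ≥0) < (t₀ : WithTop ℝ≥0)}.indicator x
        (ω, s)) continuousAt_const ?_
  filter_upwards [hloc] with t ht
  simp only [Set.indicator, Set.mem_ofPred_eq, WithTop.coe_lt_coe, ht]

theorem tendsto_accrued_min {x : Ω × ℝ≥0 → ℝ} {ω : Ω} (τ : Ω → WithTop ℝ≥0)
    (hx : Integrable (fun s => x (ω, s)) timeMeasure) :
    Tendsto (fun n : ℕ => accrued x timeZero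
      (fun ω => min (τ ω) ((n : ℝ≥0) : WithTop ℝ≥0)) ω) atTop (𝓝 (accrued x timeZero τ ω)) := by
  simp_rw [accrued_eq_integral_indicator]
  refine tendsto_integral_of_dominated_convergence (fun s => ‖x (ω, s)‖) (fun n => ?_) hx.norm
    (fun n => Eventually.of_forall fun s => norm_indicator_le_norm_self _ _)
    (Eventually.of_forall fun s => ?_)
  · exact (hx.indicator (measurableSet_timeWindow (timeZero ω)
      (min (τ ω) ((n : ℝ≥0) : WithTop ℝ≥0)))).aestronglyMeasurable
  · refine tendsto_const_nhds.congr' ?_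
    obtain ⟨N, hN⟩ := exists_nat_gt s
    filter_upwards [eventually_ge_atTop N] with n hn
    have hsn : (s : WithTop ℝ≥0) < ((n : ℝ≥0) : WithTop ℝ≥0) :=
      WithTop.coe_lt_coe.2 (hN.trans_le (by exact_mod_cast hn))
    simp only [Set.indicator, Set.mem_ofPred_eq, lt_min_iff, hsn, and_true]
    congr

/-- Accrued revenue is adapted and has continuous paths, hence is progressively measurable and may
be evaluated at stopping times. -/
theorem aestronglyMeasurable_accrued (h𝓕 : UsualConditions 𝓕 P) {x : Ω × ℝ≥0 → ℝ}
    (hx : IsRevenueStream P 𝓕 x) (τ : StoppingTime 𝓕) :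
    AEStronglyMeasurable[τ.sigma] (accrued x timeZero τ.time) P := by
  have hint : ∀ᵐ ω ∂P, Integrable (fun s => x (ω, s)) timeMeasure := hx.integrable.prod_right_ae
  -- Paths are continuous where the stream is integrable. The exceptional set is null, so by
  -- completeness removing it preserves adaptedness.
  let G : Set Ω := {ω | Integrable (fun s => x (ω, s)) timeMeasure}
  have hG0 : P Gᶜ = 0 := hint
  let u : ℝ≥0 → Ω → ℝ := fun t => G.indicator (accrued x timeZero fun _ => (t : WithTop ℝ≥0))
  have hadapt : StronglyAdapted 𝓕 u := fun t => by
    have hGt : MeasurableSet[𝓕 t] G :=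
      (𝓕.mono zero_le Gᶜ (h𝓕.complete _ hG0)).of_compl
    exact (Measurable.indicator (hx.adapted t) hGt).stronglyMeasurable
  have hcont : ∀ ω, Continuous fun t => u t ω := by
    intro ω
    by_cases h : ω ∈ G
    · simpa [u, h] using continuous_accrued h
    · simpa [u, h] using continuous_const
  have hprog := hadapt.isStronglyProgressive_of_continuous hcont
  -- Truncation at `n` is needed because `stoppedValue` uses a default date where `τ = ∞`; the total
  -- accrued revenue is recovered as `n → ∞`.
  have hmin : ∀ n : ℕ, Measurable[τ.sigma]
      (G.indicator (accrued x timeZero fun ω => min (τ.time ω) ((n : ℝ≥0) : WithTop ℝ≥0))) := by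
    intro n
    have h1 := measurable_stoppedValue hprog (τ.isStoppingTime.min_const (n : ℝ≥0))
    have h2 : (τ.isStoppingTime.min_const (n : ℝ≥0)).measurableSpace ≤ τ.sigma :=
      IsStoppingTime.measurableSpace_mono _ _ fun ω => min_le_left _ _
    have h3 : stoppedValue u (fun ω => min (τ.time ω) ((n : ℝ≥0) : WithTop ℝ≥0)) =
        G.indicator (accrued x timeZero fun ω => min (τ.time ω) ((n : ℝ≥0) : WithTop ℝ≥0)) := by
      ext ω
      have hne : min (τ.time ω) ((n : ℝ≥0) : WithTop ℝ≥0) ≠ ⊤ :=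
        ne_top_of_le_ne_top WithTop.coe_ne_top (min_le_right _ _)
      simp only [stoppedValue, u]
      by_cases h : ω ∈ G
      · simp only [Set.indicator_of_mem h]
        exact accrued_congr rfl ((WithTop.untopA_eq_untop hne ▸ WithTop.coe_untop _ hne))
      · simp only [Set.indicator_of_notMem h]
    rw [← h3]
    exact h1.mono h2 le_rfl
  have hlim : Measurable[τ.sigma] (G.indicator (accrued x timeZero τ.time)) := by
    refine @measurable_of_tendsto_metrizable _ _ τ.sigma _ _ _ _ _ _ hmin ?_
    rw [tendsto_pi_nhds]
    intro ω
    by_cases h : ω ∈ G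
    · simpa only [Set.indicator_of_mem h] using tendsto_accrued_min τ.time h
    · simp only [Set.indicator_of_notMem h]
      exact tendsto_const_nhds
  refine ⟨_, hlim.stronglyMeasurable, ?_⟩
  filter_upwards [hint] with ω hω
  exact (Set.indicator_of_mem (s := G) hω _).symm

end Adapted

/-! ### Payoffs as conditional expectations -/

section Payoffs

variable {𝓕 : Filtration ℝ≥0 mΩ} {P : Measure Ω}

namespace Revenues

variable (R : Revenues P 𝓕) (i : Fin 2)

/-- The stream whose accrued revenue the follower maximizes, up to a constant. -/
def waitingStream : Ω × ℝ≥0 → ℝ := R.piF i - R.piB i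

theorem integrable_waitingStream : Integrable (R.waitingStream i) (P.prod timeMeasure) :=
  (R.streamF i).integrable.sub (R.streamB i).integrable

/-- A common bound on the total revenues of firm `i`. -/
def revenueBound (ω : Ω) : ℝ :=
  (∫ s, |R.pi0 i (ω, s)| ∂timeMeasure) + (∫ s, |R.piL i (ω, s)| ∂timeMeasure) +
    ∫ s, |R.piB i (ω, s)| ∂timeMeasure

theorem integrable_revenueBound : Integrable (R.revenueBound i) P :=
  ((R.stream0 i).integrable.abs.integral_prod_left.add
    (R.streamL i).integrable.abs.integral_prod_left).add
    (R.streamB i).integrable.abs.integral_prod_left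

end Revenues

variable [IsProbabilityMeasure P]

/-- Past revenue is known at `τ`, so it may be moved inside the conditional expectation. Payoffs can
then be compared pathwise through their gross revenues. -/
theorem accrued_add_condExp (h𝓕 : UsualConditions 𝓕 P) {x : Ω × ℝ≥0 → ℝ}
    (hx : IsRevenueStream P 𝓕 x) (τ : StoppingTime 𝓕) {f : Ω → ℝ} (hf : Integrable f P) :
    accrued x timeZero τ.time + P[f | τ.sigma] =ᵐ[P]
      P[accrued x timeZero τ.time + f | τ.sigma] := by
  have hi := integrable_accrued_stoppingTime hx.integrable τ
  filter_upwards [condExp_add hi hf τ.sigma, condExp_of_aestronglyMeasurable' τ.sigma_le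
    (aestronglyMeasurable_accrued h𝓕 hx τ) hi] with ω h1 h2
  rw [h1, Pi.add_apply, Pi.add_apply, h2]

namespace Revenues

variable (R : Revenues P 𝓕) (i : Fin 2)

theorem ae_integrable_path {x : Ω × ℝ≥0 → ℝ} (hx : IsRevenueStream P 𝓕 x) :
    ∀ᵐ ω ∂P, Integrable (fun s => x (ω, s)) timeMeasure :=
  hx.integrable.prod_right_ae

theorem ae_accrued_piB_le_piL : ∀ᵐ ω ∂P, ∀ a b : Ω → WithTop ℝ≥0,
    accrued (R.piB i) a b ω ≤ accrued (R.piL i) a b ω := by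
  filter_upwards [Measure.ae_ae_of_ae_prod (R.piB_le_piL i), ae_integrable_path (R.streamB i),
    ae_integrable_path (R.streamL i)] with ω h hB hL a b
  exact accrued_mono_stream hB hL h

theorem ae_accrued_piF_le_pi0 : ∀ᵐ ω ∂P, ∀ a b : Ω → WithTop ℝ≥0,
    accrued (R.piF i) a b ω ≤ accrued (R.pi0 i) a b ω := by
  filter_upwards [Measure.ae_ae_of_ae_prod (R.piF_le_pi0 i), ae_integrable_path (R.streamF i),
    ae_integrable_path (R.stream0 i)] with ω h hF h0 a b
  exact accrued_mono_stream hF h0 h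

theorem integrable_followerReward (τ σ : StoppingTime 𝓕) :
    Integrable (R.followerReward i τ σ) P :=
  (integrable_accrued (R.streamF i).integrable τ.measurable σ.measurable).add
    (integrable_accrued (R.streamB i).integrable σ.measurable measurable_timeInfty)

/-- Extending both integrals back to date `0` isolates the dependence on `c` in a term free of `τ`.
Problems starting at different dates thus share one objective, as the exchange argument requires. -/
theorem followerReward_ae_eq {τ c : StoppingTime 𝓕} (hc : c ∈ notBefore P τ) :
    R.followerReward i τ c =ᵐ[P] accrued (R.waitingStream i) timeZero c.time +
      (accrued (R.piB i) timeZero timeInfty - accrued (R.piF i) timeZero τ.time) := by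
  filter_upwards [mem_notBefore.1 hc, ae_integrable_path (R.streamF i),
    ae_integrable_path (R.streamB i)] with ω hω hF hB
  have h1 := accrued_add (a := timeZero) hF (timeZero_le _ _) hω
  have h2 := accrued_add (a := timeZero) hB (timeZero_le _ _) (le_timeInfty (c.time ω) ω)
  simp only [followerReward, Pi.add_apply, Pi.sub_apply, waitingStream]
  rw [accrued_sub hF hB]
  linarith

theorem condExp_followerReward {τ c : StoppingTime 𝓕} (hc : c ∈ notBefore P τ) :
    P[R.followerReward i τ c | τ.sigma] =ᵐ[P]
      P[accrued (R.waitingStream i) timeZero c.time | τ.sigma] +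
      P[accrued (R.piB i) timeZero timeInfty - accrued (R.piF i) timeZero τ.time | τ.sigma] :=
  (condExp_congr_ae (R.followerReward_ae_eq i hc)).trans <|
    condExp_add (integrable_accrued_stoppingTime (R.integrable_waitingStream i) c)
      ((integrable_accrued (R.streamB i).integrable measurable_timeZero measurable_timeInfty).sub
        (integrable_accrued_stoppingTime (R.streamF i).integrable τ)) _

variable {R i} in
theorem condExp_followerReward_le (h𝓕 : UsualConditions 𝓕 P) {τ a c : StoppingTime 𝓕}
    (ha : IsLatestMax P (R.waitingStream i) τ a) (hc : c ∈ notBefore P τ) :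
    P[R.followerReward i τ c | τ.sigma] ≤ᵐ[P] P[R.followerReward i τ a | τ.sigma] := by
  filter_upwards [R.condExp_followerReward i hc, R.condExp_followerReward i ha.mem,
    ha.condExp_le h𝓕 (R.integrable_waitingStream i) hc] with ω h1 h2 h3
  rw [h1, h2, Pi.add_apply, Pi.add_apply]
  linarith

variable {R i} in
theorem isLatestOn_of_isLatestMax (h𝓕 : UsualConditions 𝓕 P) {τ a : StoppingTime 𝓕}
    (ha : IsLatestMax P (R.waitingStream i) τ a) :
    IsLatestOn P τ (R.followerReward i τ) a Set.univ := by
  have hval := stopValue_ae_eq (X := R.followerReward i τ) ha.mem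
    fun c hc => condExp_followerReward_le h𝓕 ha hc
  refine ⟨⟨ha.mem, hval.mono fun ω h _ => h.symm⟩, fun c hc => ?_⟩
  filter_upwards [hval, R.condExp_followerReward i hc, R.condExp_followerReward i ha.mem,
    ha.le_of_condExp_eq h𝓕 (R.integrable_waitingStream i) hc] with ω h1 h2 h3 h4 _ h5
  rw [h1, h2, h3, Pi.add_apply, Pi.add_apply] at h5
  exact h4 (add_right_cancel h5)

/-- The follower reaction time exists and maximizes the expected accrued waiting stream. -/
theorem isLatestMax_followerTime (h𝓕 : UsualConditions 𝓕 P) (τ : StoppingTime 𝓕) :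
    IsLatestMax P (R.waitingStream i) τ (R.followerTime i τ) := by
  obtain ⟨a, ha⟩ := exists_isLatestMax h𝓕 (R.integrable_waitingStream i) τ
  have hL := isLatestOn_of_isLatestMax h𝓕 ha
  have hex : ∃ σ, IsLatestOn P τ (R.followerReward i τ) σ Set.univ := ⟨a, hL⟩
  have hF : IsLatestOn P τ (R.followerReward i τ) (R.followerTime i τ) Set.univ := by
    rw [followerTime, dif_pos hex]
    exact hex.choose_spec
  -- Two latest solutions bound each other, so the chosen reaction time coincides almost surely with
  -- the constructed maximizer.
  refine ha.congr ?_
  filter_upwards [hL.2 _ hF.1.1, hF.2 _ ha.mem, hL.1.2, hF.1.2] with ω h1 h2 h3 h4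
  exact le_antisymm (h2 trivial (h3 trivial)) (h1 trivial (h4 trivial))

theorem followerTime_mem (h𝓕 : UsualConditions 𝓕 P) (τ : StoppingTime 𝓕) :
    R.followerTime i τ ∈ notBefore P τ :=
  (R.isLatestMax_followerTime i h𝓕 τ).mem

theorem followerTime_le_of_le (h𝓕 : UsualConditions 𝓕 P) (σ ρ : StoppingTime 𝓕) :
    ∀ᵐ ω ∂P, σ.time ω ≤ ρ.time ω →
      (R.followerTime i σ).time ω ≤ (R.followerTime i ρ).time ω :=
  (R.isLatestMax_followerTime i h𝓕 σ).le_of_le h𝓕 (R.integrable_waitingStream i)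
    (R.isLatestMax_followerTime i h𝓕 ρ)

theorem followerTime_eq_of_eq (h𝓕 : UsualConditions 𝓕 P) (σ ρ : StoppingTime 𝓕) :
    ∀ᵐ ω ∂P, σ.time ω = ρ.time ω →
      (R.followerTime i σ).time ω = (R.followerTime i ρ).time ω := by
  filter_upwards [R.followerTime_le_of_le i h𝓕 σ ρ, R.followerTime_le_of_le i h𝓕 ρ σ]
    with ω h1 h2 h
  exact le_antisymm (h1 h.le) (h2 h.ge)

theorem integrable_leaderReward (τ : StoppingTime 𝓕) : Integrable (R.leaderReward i τ) P :=
  (integrable_accrued (R.streamL i).integrable τ.measurable (StoppingTime.measurable _)).add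
    (integrable_accrued (R.streamB i).integrable (StoppingTime.measurable _) measurable_timeInfty)

/-- The total revenue of firm `i` if it leads at `τ`. -/
def leaderGross (τ : StoppingTime 𝓕) : Ω → ℝ :=
  accrued (R.pi0 i) timeZero τ.time + R.leaderReward i τ

/-- The total revenue of firm `i` if its opponent leads at `τ`. -/
def followerGross (τ : StoppingTime 𝓕) : Ω → ℝ :=
  accrued (R.pi0 i) timeZero τ.time + R.followerReward i τ (R.followerTime i τ)

/-- The total revenue of firm `i` if both firms invest at `τ`. -/
def simultaneousGross (τ : StoppingTime 𝓕) : Ω → ℝ :=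
  accrued (R.pi0 i) timeZero τ.time + accrued (R.piB i) τ.time timeInfty

theorem integrable_accrued_pi0 (τ : StoppingTime 𝓕) :
    Integrable (accrued (R.pi0 i) timeZero τ.time) P :=
  integrable_accrued_stoppingTime (R.stream0 i).integrable τ

theorem integrable_leaderGross (τ : StoppingTime 𝓕) : Integrable (R.leaderGross i τ) P :=
  (R.integrable_accrued_pi0 i τ).add (R.integrable_leaderReward i τ)

theorem integrable_followerGross (τ : StoppingTime 𝓕) : Integrable (R.followerGross i τ) P :=
  (R.integrable_accrued_pi0 i τ).add (R.integrable_followerReward i τ _)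

theorem integrable_simultaneousGross (τ : StoppingTime 𝓕) :
    Integrable (R.simultaneousGross i τ) P :=
  (R.integrable_accrued_pi0 i τ).add
    (integrable_accrued (R.streamB i).integrable τ.measurable measurable_timeInfty)

theorem leader_ae_eq (h𝓕 : UsualConditions 𝓕 P) (τ : StoppingTime 𝓕) :
    R.leader i τ =ᵐ[P] P[R.leaderGross i τ | τ.sigma] :=
  accrued_add_condExp h𝓕 (R.stream0 i) τ (R.integrable_leaderReward i τ)

theorem simultaneous_ae_eq (h𝓕 : UsualConditions 𝓕 P) (τ : StoppingTime 𝓕) :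
    R.simultaneous i τ =ᵐ[P] P[R.simultaneousGross i τ | τ.sigma] :=
  accrued_add_condExp h𝓕 (R.stream0 i) τ
    (integrable_accrued (R.streamB i).integrable τ.measurable measurable_timeInfty)

theorem follower_ae_eq (h𝓕 : UsualConditions 𝓕 P) (τ : StoppingTime 𝓕) :
    R.follower i τ =ᵐ[P] P[R.followerGross i τ | τ.sigma] := by
  have hval := stopValue_ae_eq (X := R.followerReward i τ) (R.followerTime_mem i h𝓕 τ)
    fun c hc => condExp_followerReward_le h𝓕 (R.isLatestMax_followerTime i h𝓕 τ) hc
  filter_upwards [hval, accrued_add_condExp h𝓕 (R.stream0 i) τ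
    (R.integrable_followerReward i τ (R.followerTime i τ))] with ω h1 h2
  rw [follower, h1]
  exact h2

theorem integrable_leader (h𝓕 : UsualConditions 𝓕 P) (τ : StoppingTime 𝓕) :
    Integrable (R.leader i τ) P :=
  integrable_condExp.congr (R.leader_ae_eq i h𝓕 τ).symm

theorem integrable_simultaneous (h𝓕 : UsualConditions 𝓕 P) (τ : StoppingTime 𝓕) :
    Integrable (R.simultaneous i τ) P :=
  integrable_condExp.congr (R.simultaneous_ae_eq i h𝓕 τ).symm

theorem integrable_follower (h𝓕 : UsualConditions 𝓕 P) (τ : StoppingTime 𝓕) :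
    Integrable (R.follower i τ) P :=
  integrable_condExp.congr (R.follower_ae_eq i h𝓕 τ).symm

theorem condExp_leader (h𝓕 : UsualConditions 𝓕 P) {ϑ τ : StoppingTime 𝓕}
    (hτ : τ ∈ notBefore P ϑ) :
    P[R.leader i τ | ϑ.sigma] =ᵐ[P] P[R.leaderGross i τ | ϑ.sigma] :=
  (condExp_congr_ae (R.leader_ae_eq i h𝓕 τ)).trans
    (condExp_condExp_of_le (sigma_mono h𝓕 hτ) τ.sigma_le)

theorem leaderGross_le_revenueBound (τ : StoppingTime 𝓕) :
    R.leaderGross i τ ≤ᵐ[P] R.revenueBound i := by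
  filter_upwards [ae_integrable_path (R.stream0 i), ae_integrable_path (R.streamL i),
    ae_integrable_path (R.streamB i)] with ω h0 hL hB
  have h1 := (le_abs_self _).trans (abs_accrued_le (a := timeZero) (b := τ.time) h0)
  have h2 := (le_abs_self _).trans
    (abs_accrued_le (a := τ.time) (b := (R.followerTime (opponent i) τ).time) hL)
  have h3 := (le_abs_self _).trans
    (abs_accrued_le (a := (R.followerTime (opponent i) τ).time) (b := timeInfty) hB)
  simp only [leaderGross, leaderReward, revenueBound, Pi.add_apply]
  linarith

theorem isEssSup_stopValue_leader (h𝓕 : UsualConditions 𝓕 P) (ϑ : StoppingTime 𝓕) :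
    IsEssSup P (notBefore P ϑ) (fun τ => P[R.leader i τ | ϑ.sigma])
      (stopValue P ϑ (R.leader i)) := by
  refine isEssSup_stopValue ϑ (P[R.revenueBound i | ϑ.sigma]) fun τ hτ => ?_
  exact (R.condExp_leader i h𝓕 hτ).le.trans (condExp_mono (R.integrable_leaderGross i τ)
    (R.integrable_revenueBound i) (R.leaderGross_le_revenueBound i τ))

/-! ### The monopoly problem -/

theorem integrable_monopoly (τ : StoppingTime 𝓕) : Integrable (R.monopoly i τ) P :=
  (R.integrable_accrued_pi0 i τ).add
    (integrable_accrued (R.streamL i).integrable τ.measurable measurable_timeInfty)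

theorem monopoly_le_revenueBound (τ : StoppingTime 𝓕) :
    R.monopoly i τ ≤ᵐ[P] R.revenueBound i := by
  filter_upwards [ae_integrable_path (R.stream0 i), ae_integrable_path (R.streamL i)]
    with ω h0 hL
  have h1 := (le_abs_self _).trans (abs_accrued_le (a := timeZero) (b := τ.time) h0)
  have h2 := (le_abs_self _).trans (abs_accrued_le (a := τ.time) (b := timeInfty) hL)
  have h3 : 0 ≤ ∫ s, |R.piB i (ω, s)| ∂timeMeasure := integral_nonneg fun _ => abs_nonneg _
  simp only [monopoly, revenueBound]
  linarith

/-- The revenue that a leader loses because the opponent follows. -/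
def followerDamage (τ : StoppingTime 𝓕) : Ω → ℝ :=
  accrued (R.piL i - R.piB i) (R.followerTime (opponent i) τ).time timeInfty

theorem integrable_followerDamage (τ : StoppingTime 𝓕) : Integrable (R.followerDamage i τ) P :=
  integrable_accrued ((R.streamL i).integrable.sub (R.streamB i).integrable)
    (StoppingTime.measurable _) measurable_timeInfty

theorem monopoly_ae_eq (h𝓕 : UsualConditions 𝓕 P) (τ : StoppingTime 𝓕) :
    R.monopoly i τ =ᵐ[P] R.leaderGross i τ + R.followerDamage i τ := by
  filter_upwards [ae_integrable_path (R.streamL i), ae_integrable_path (R.streamB i),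
    mem_notBefore.1 (R.followerTime_mem (opponent i) h𝓕 τ)] with ω hL hB hle
  have h1 := accrued_add hL hle (le_timeInfty _ ω)
  simp only [monopoly, leaderGross, leaderReward, followerDamage, Pi.add_apply]
  rw [accrued_sub hL hB]
  linarith

/-- A later lead delays the reaction, and the part of the loss thereby avoided is nonnegative
because `piB ≤ piL`. -/
theorem followerDamage_antitone (h𝓕 : UsualConditions 𝓕 P) {ϑ τ : StoppingTime 𝓕}
    (hτ : τ ∈ notBefore P ϑ) : R.followerDamage i τ ≤ᵐ[P] R.followerDamage i ϑ := by
  filter_upwards [ae_integrable_path (R.streamL i), ae_integrable_path (R.streamB i),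
    mem_notBefore.1 hτ, R.followerTime_le_of_le (opponent i) h𝓕 ϑ τ, R.ae_accrued_piB_le_piL i]
    with ω hL hB hle hF hBL
  have h1 := accrued_add hL (hF hle) (le_timeInfty _ ω)
  have h2 := accrued_add hB (hF hle) (le_timeInfty _ ω)
  have h3 := hBL (R.followerTime (opponent i) ϑ).time (R.followerTime (opponent i) τ).time
  simp only [followerDamage]
  rw [accrued_sub hL hB, accrued_sub hL hB]
  linarith

theorem condExp_monopoly (h𝓕 : UsualConditions 𝓕 P) {ϑ τ : StoppingTime 𝓕}
    (hτ : τ ∈ notBefore P ϑ) : P[R.monopoly i τ | ϑ.sigma] =ᵐ[P]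
      P[R.leader i τ | ϑ.sigma] + P[R.followerDamage i τ | ϑ.sigma] := by
  filter_upwards [condExp_congr_ae (m := ϑ.sigma) (R.monopoly_ae_eq i h𝓕 τ),
    condExp_add (R.integrable_leaderGross i τ) (R.integrable_followerDamage i τ) ϑ.sigma,
    R.condExp_leader i h𝓕 hτ] with ω h1 h2 h3
  rw [h1, h2, Pi.add_apply, Pi.add_apply, h3]

/-- If a leader optimally invests at once, so does a monopolist. -/
theorem attainsOn_monopoly_of_leader (h𝓕 : UsualConditions 𝓕 P) {ϑ : StoppingTime 𝓕}
    {C : Set Ω} (hC : MeasurableSet C) (h : AttainsOn P ϑ (R.leader i) ϑ C) :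
    AttainsOn P ϑ (R.monopoly i) ϑ C := by
  refine attainsOn_of_forall_le (isEssSup_stopValue ϑ (P[R.revenueBound i | ϑ.sigma])
    fun τ _ => condExp_mono (R.integrable_monopoly i τ) (R.integrable_revenueBound i)
      (R.monopoly_le_revenueBound i τ)) h.1 hC fun τ hτ => ?_
  filter_upwards [h.2, (R.isEssSup_stopValue_leader i h𝓕 ϑ).upper τ hτ,
    R.condExp_monopoly i h𝓕 hτ, R.condExp_monopoly i h𝓕 h.1,
    condExp_mono (m := ϑ.sigma) (R.integrable_followerDamage i τ)
      (R.integrable_followerDamage i ϑ) (R.followerDamage_antitone i h𝓕 hτ)]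
    with ω h1 h2 h3 h4 h5 hω
  have h6 := h1 hω
  rw [h3, h4, Pi.add_apply, Pi.add_apply]
  linarith

end Revenues

end Payoffs

/-! ### The preemption game -/

section Game

variable {𝓕 : Filtration ℝ≥0 mΩ} {P : Measure Ω}

theorem TieRule.lead_add_lead_add_both (tie : TieRule 𝓕) (i : Fin 2) (τ : StoppingTime 𝓕)
    (ω : Ω) : tie.lead i τ ω + tie.lead (opponent i) τ ω + tie.both τ ω = 1 := by
  have h := tie.sum_eq_one τ ω
  fin_cases i
  · simpa [opponent] using h
  · simp only [opponent, Fin.mk_one, sub_self]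
    linarith

variable [IsProbabilityMeasure P]

namespace Revenues

variable (R : Revenues P 𝓕) (i : Fin 2)

/-- Payoffs are defined for each stopping time separately, so their dependence on the date alone
needs proof. It rests on the reaction time being local and on conditional expectations agreeing
where stopping times do. -/
theorem leader_eq_of_eq (h𝓕 : UsualConditions 𝓕 P) (σ ρ : StoppingTime 𝓕) :
    ∀ᵐ ω ∂P, σ.time ω = ρ.time ω → R.leader i σ ω = R.leader i ρ ω := by
  have hrew : ∀ᵐ ω ∂P, σ.time ω = ρ.time ω →
      R.leaderReward i σ ω = R.leaderReward i ρ ω := by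
    filter_upwards [R.followerTime_eq_of_eq (opponent i) h𝓕 σ ρ] with ω h hω
    simp only [leaderReward]
    rw [accrued_congr hω (h hω), accrued_congr (h hω) (rfl : timeInfty ω = timeInfty ω)]
  filter_upwards [condExp_eq_on_eq σ ρ (R.integrable_leaderReward i σ)
    (R.integrable_leaderReward i ρ) hrew] with ω h hω
  simp only [leader]
  rw [h hω, accrued_congr (rfl : timeZero ω = timeZero ω) hω]

/-- What firm `i` expects at `τ` from leading at its own follower reaction time. -/
def delayedLeader (τ : StoppingTime 𝓕) : Ω → ℝ :=
  P[R.leader i (R.followerTime i τ) | τ.sigma]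

/-- The better of leading at `τ` and leading at the follower reaction time to `τ`. -/
def bestLeader (τ : StoppingTime 𝓕) (ω : Ω) : ℝ :=
  max (R.leader i τ ω) (R.delayedLeader i τ ω)

theorem delayedLeader_eq_of_eq (h𝓕 : UsualConditions 𝓕 P) (σ ρ : StoppingTime 𝓕) :
    ∀ᵐ ω ∂P, σ.time ω = ρ.time ω → R.delayedLeader i σ ω = R.delayedLeader i ρ ω := by
  refine condExp_eq_on_eq σ ρ (R.integrable_leader i h𝓕 _) (R.integrable_leader i h𝓕 _) ?_
  filter_upwards [R.followerTime_eq_of_eq i h𝓕 σ ρ,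
    R.leader_eq_of_eq i h𝓕 (R.followerTime i σ) (R.followerTime i ρ)] with ω h1 h2 h
  exact h2 (h1 h)

theorem bestLeader_eq_of_eq (h𝓕 : UsualConditions 𝓕 P) (σ ρ : StoppingTime 𝓕) :
    ∀ᵐ ω ∂P, σ.time ω = ρ.time ω → R.bestLeader i σ ω = R.bestLeader i ρ ω := by
  filter_upwards [R.leader_eq_of_eq i h𝓕 σ ρ, R.delayedLeader_eq_of_eq i h𝓕 σ ρ]
    with ω h1 h2 h
  rw [bestLeader, bestLeader, h1 h, h2 h]

/-- Following is no better than leading at the follower reaction time. -/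
theorem follower_le_delayedLeader (h𝓕 : UsualConditions 𝓕 P) (τ : StoppingTime 𝓕) :
    R.follower i τ ≤ᵐ[P] R.delayedLeader i τ := by
  have hmem := R.followerTime_mem i h𝓕 τ
  -- Leading at the reaction time earns `pi0` instead of `piF` before that date, and `piL` instead
  -- of `piB` until the opponent reacts in turn.
  have hle : R.followerGross i τ ≤ᵐ[P] R.leaderGross i (R.followerTime i τ) := by
    filter_upwards [ae_integrable_path (R.stream0 i), ae_integrable_path (R.streamB i),
      mem_notBefore.1 hmem, R.ae_accrued_piB_le_piL i, R.ae_accrued_piF_le_pi0 i,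
      mem_notBefore.1 (R.followerTime_mem (opponent i) h𝓕 (R.followerTime i τ))]
      with ω h0 hB hτ hBL hF0 hj
    have h1 := accrued_add (a := timeZero) h0 (timeZero_le _ _) hτ
    have h2 := accrued_add hB hj (le_timeInfty _ ω)
    have h3 := hF0 τ.time (R.followerTime i τ).time
    have h4 := hBL (R.followerTime i τ).time
      (R.followerTime (opponent i) (R.followerTime i τ)).time
    simp only [followerGross, followerReward, leaderGross, leaderReward, Pi.add_apply]
    linarith
  filter_upwards [R.follower_ae_eq i h𝓕 τ, R.condExp_leader i h𝓕 hmem,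
    condExp_mono (m := τ.sigma) (R.integrable_followerGross i τ)
      (R.integrable_leaderGross i _) hle] with ω h1 h2 h3
  rw [h1, delayedLeader, h2]
  exact h3

/-- Leading is no worse than simultaneous investment. -/
theorem simultaneous_le_leader (h𝓕 : UsualConditions 𝓕 P) (τ : StoppingTime 𝓕) :
    R.simultaneous i τ ≤ᵐ[P] R.leader i τ := by
  have hle : R.simultaneousGross i τ ≤ᵐ[P] R.leaderGross i τ := by
    filter_upwards [ae_integrable_path (R.streamB i), R.ae_accrued_piB_le_piL i,
      mem_notBefore.1 (R.followerTime_mem (opponent i) h𝓕 τ)] with ω hB hBL hj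
    have h1 := accrued_add hB hj (le_timeInfty _ ω)
    have h2 := hBL τ.time (R.followerTime (opponent i) τ).time
    simp only [simultaneousGross, leaderGross, leaderReward, Pi.add_apply]
    linarith
  filter_upwards [R.leader_ae_eq i h𝓕 τ, R.simultaneous_ae_eq i h𝓕 τ,
    condExp_mono (m := τ.sigma) (R.integrable_simultaneousGross i τ)
      (R.integrable_leaderGross i τ) hle] with ω h1 h2 h3
  rw [h1, h2]
  exact h3

/-- The tie payoff is a convex combination of three payoffs, each bounded by `bestLeader`; this is
why the tie rule is irrelevant. -/
theorem tiePayoff_le_bestLeader (h𝓕 : UsualConditions 𝓕 P) (tie : TieRule 𝓕)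
    (τ : StoppingTime 𝓕) : R.tiePayoff tie i τ ≤ᵐ[P] R.bestLeader i τ := by
  filter_upwards [R.follower_le_delayedLeader i h𝓕 τ, R.simultaneous_le_leader i h𝓕 τ]
    with ω h1 h2
  have hL : R.leader i τ ω ≤ R.bestLeader i τ ω := le_max_left _ _
  have hF : R.follower i τ ω ≤ R.bestLeader i τ ω := h1.trans (le_max_right _ _)
  have hM : R.simultaneous i τ ω ≤ R.bestLeader i τ ω := h2.trans hL
  calc R.tiePayoff tie i τ ω
      ≤ tie.lead i τ ω * R.bestLeader i τ ω + tie.lead (opponent i) τ ω * R.bestLeader i τ ω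
          + tie.both τ ω * R.bestLeader i τ ω :=
        add_le_add (add_le_add (mul_le_mul_of_nonneg_left hL (tie.lead_nonneg _ _ _))
          (mul_le_mul_of_nonneg_left hF (tie.lead_nonneg _ _ _)))
          (mul_le_mul_of_nonneg_left hM (tie.both_nonneg _ _))
    _ = R.bestLeader i τ ω := by
        rw [← add_mul, ← add_mul, tie.lead_add_lead_add_both, one_mul]

theorem outcome_le_bestLeader (h𝓕 : UsualConditions 𝓕 P) (tie : TieRule 𝓕)
    (τ σ : StoppingTime 𝓕) : R.outcome tie i τ σ ≤ᵐ[P] R.bestLeader i (τ.min σ) := by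
  filter_upwards [R.tiePayoff_le_bestLeader i h𝓕 tie τ, R.follower_le_delayedLeader i h𝓕 σ,
    R.bestLeader_eq_of_eq i h𝓕 τ (τ.min σ), R.bestLeader_eq_of_eq i h𝓕 σ (τ.min σ)]
    with ω h1 h2 h3 h4
  simp only [outcome, Pi.add_apply, Set.indicator, Set.mem_ofPred_eq]
  rcases lt_trichotomy (τ.time ω) (σ.time ω) with h | h | h
  · rw [← h3 (min_eq_left h.le).symm]
    simp only [h, h.not_gt, h.ne, if_true, if_false, add_zero]
    exact le_max_left _ _
  · rw [← h3 (min_eq_left h.le).symm]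
    simpa [h] using h1
  · rw [← h4 (min_eq_right h.le).symm]
    simp only [h, h.not_gt, h.ne', if_true, if_false, add_zero, zero_add]
    exact h2.trans (le_max_right _ _)

/-- The better of leading now and leading at the follower reaction time is the payoff of leading
at a suitable stopping time. -/
theorem exists_condExp_leader_eq_bestLeader (h𝓕 : UsualConditions 𝓕 P) (κ : StoppingTime 𝓕) :
    ∃ σ ∈ notBefore P κ, R.bestLeader i κ =ᵐ[P] P[R.leader i σ | κ.sigma] := by
  -- The comparison event uses the conditional expectation of the leader payoff, an almost surely
  -- equal version that is exactly measurable at `κ`, as gluing requires.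
  have hA : MeasurableSet[κ.sigma]
      {ω | R.delayedLeader i κ ω ≤ (P[R.leader i κ | κ.sigma]) ω} :=
    StronglyMeasurable.measurableSet_le stronglyMeasurable_condExp stronglyMeasurable_condExp
  have hmem := R.followerTime_mem i h𝓕 κ
  obtain ⟨σ, hσ, hσ'⟩ := exists_glue h𝓕 hA (self_mem_notBefore κ) hmem
  refine ⟨σ, glue_mem_notBefore (self_mem_notBefore κ) hmem hσ hσ', ?_⟩
  have hL : R.leader i κ =ᵐ[P] P[R.leader i κ | κ.sigma] :=
    (R.leader_ae_eq i h𝓕 κ).trans (R.condExp_leader i h𝓕 (self_mem_notBefore κ)).symm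
  filter_upwards [hL,
    condExp_eq_on hA (R.integrable_leader i h𝓕 σ) (R.integrable_leader i h𝓕 κ)
      ((R.leader_eq_of_eq i h𝓕 σ κ).mono fun ω h hω => h (hσ ω hω)),
    condExp_eq_on hA.compl (R.integrable_leader i h𝓕 σ) (R.integrable_leader i h𝓕 _)
      ((R.leader_eq_of_eq i h𝓕 σ (R.followerTime i κ)).mono fun ω h hω => h (hσ' ω hω))]
    with ω h1 h2 h3
  by_cases h : ω ∈ {ω | R.delayedLeader i κ ω ≤ (P[R.leader i κ | κ.sigma]) ω}
  · rw [bestLeader, h2 h, h1]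
    exact max_eq_left h
  · rw [bestLeader, h3 h, h1]
    exact max_eq_right (not_le.1 h).le

theorem integrable_tiePayoff (h𝓕 : UsualConditions 𝓕 P) (tie : TieRule 𝓕)
    (τ : StoppingTime 𝓕) : Integrable (R.tiePayoff tie i τ) P := by
  have hsum := tie.lead_add_lead_add_both i τ
  have h1 := tie.lead_nonneg i τ
  have h2 := tie.lead_nonneg (opponent i) τ
  have h3 := tie.both_nonneg τ
  have hmul : ∀ {p f : Ω → ℝ}, Measurable[τ.sigma] p → (∀ ω, 0 ≤ p ω) → (∀ ω, p ω ≤ 1) →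
      Integrable f P → Integrable (fun ω => p ω * f ω) P := fun hp h0 h1 hf =>
    hf.bdd_mul (hp.mono τ.sigma_le le_rfl).aestronglyMeasurable
      (Eventually.of_forall fun ω => by
        rw [Real.norm_eq_abs, abs_of_nonneg (h0 ω)]
        exact h1 ω)
  refine ((hmul (tie.lead_measurable _ _) h1 (fun ω => ?_) (R.integrable_leader i h𝓕 τ)).add
    (hmul (tie.lead_measurable _ _) h2 (fun ω => ?_) (R.integrable_follower i h𝓕 τ))).add
    (hmul (tie.both_measurable _) h3 (fun ω => ?_) (R.integrable_simultaneous i h𝓕 τ))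
  all_goals linarith [hsum ω, h1 ω, h2 ω, h3 ω]

theorem integrable_outcome (h𝓕 : UsualConditions 𝓕 P) (tie : TieRule 𝓕)
    (τ σ : StoppingTime 𝓕) : Integrable (R.outcome tie i τ σ) P :=
  (((R.integrable_leader i h𝓕 τ).indicator (measurableSet_lt τ.measurable σ.measurable)).add
    ((R.integrable_follower i h𝓕 σ).indicator
      (measurableSet_lt σ.measurable τ.measurable))).add
    ((R.integrable_tiePayoff i h𝓕 tie τ).indicator
      (measurableSet_eq_fun τ.measurable σ.measurable))

/-- No plan of firm `i` yields more than leading at a suitable date not before the first planned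
investment. -/
theorem exists_subgamePayoff_le (h𝓕 : UsualConditions 𝓕 P) (tie : TieRule 𝓕)
    {ϑ τ σ : StoppingTime 𝓕} (hτ : τ ∈ notBefore P ϑ) (hσ : σ ∈ notBefore P ϑ) :
    ∃ ρ ∈ notBefore P (τ.min σ),
      R.subgamePayoff tie ϑ i τ σ ≤ᵐ[P] P[R.leader i ρ | ϑ.sigma] := by
  obtain ⟨ρ, hρ, hbest⟩ := R.exists_condExp_leader_eq_bestLeader i h𝓕 (τ.min σ)
  refine ⟨ρ, hρ, ?_⟩
  have h1 : R.subgamePayoff tie ϑ i τ σ ≤ᵐ[P] P[P[R.leader i ρ | (τ.min σ).sigma] | ϑ.sigma] :=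
    condExp_mono (R.integrable_outcome i h𝓕 tie τ σ) integrable_condExp
      ((R.outcome_le_bestLeader i h𝓕 tie τ σ).trans hbest.le)
  exact h1.trans (condExp_condExp_of_le (sigma_mono h𝓕 (min_mem_notBefore hτ hσ))
    (τ.min σ).sigma_le).le

/-- Where the opponent plans to invest later, immediate investment yields the leader payoff. -/
theorem subgamePayoff_self_eq (h𝓕 : UsualConditions 𝓕 P) (tie : TieRule 𝓕)
    (ϑ σ : StoppingTime 𝓕) : ∀ᵐ ω ∂P, ϑ.time ω < σ.time ω →
      R.subgamePayoff tie ϑ i ϑ σ ω = (P[R.leader i ϑ | ϑ.sigma]) ω := by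
  have hD : MeasurableSet[ϑ.sigma] {ω | ϑ.time ω < σ.time ω} := by
    have h := (σ.isStoppingTime.measurableSet_stopping_time_le ϑ.isStoppingTime).compl
    have heq : {ω | σ.time ω ≤ ϑ.time ω}ᶜ = {ω | ϑ.time ω < σ.time ω} := by
      ext ω
      simp
    rwa [heq] at h
  refine condExp_eq_on hD (R.integrable_outcome i h𝓕 tie ϑ σ) (R.integrable_leader i h𝓕 ϑ)
    (Eventually.of_forall fun ω hω => ?_)
  have h : ϑ.time ω < σ.time ω := hω
  simp [outcome, h, h.ne, h.not_gt]

/-- If immediate investment is the latest solution of the leader's problem of firm `i` on `C`, then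
in equilibrium some firm invests immediately on `C`. -/
theorem immediate_investment_of_isLatestOn (h𝓕 : UsualConditions 𝓕 P) (tie : TieRule 𝓕)
    {ϑ : StoppingTime 𝓕} {C : Set Ω} (hC : IsLatestOn P ϑ (R.leader i) ϑ C)
    {plan : Fin 2 → StoppingTime 𝓕} (hplan : R.IsSubgameEquilibrium tie ϑ plan) :
    ∀ᵐ ω ∂P, ω ∈ C →
      (plan i).time ω = ϑ.time ω ∨ (plan (opponent i)).time ω = ϑ.time ω := by
  obtain ⟨hfeas, hopt⟩ := hplan
  obtain ⟨ρ, hρ, hpay⟩ := R.exists_subgamePayoff_le i h𝓕 tie (hfeas i) (hfeas (opponent i))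
  have hρϑ : ρ ∈ notBefore P ϑ :=
    notBefore_trans (min_mem_notBefore (hfeas i) (hfeas (opponent i))) hρ
  filter_upwards [hC.1.2, hC.2 ρ hρϑ, (R.isEssSup_stopValue_leader i h𝓕 ϑ).upper ρ hρϑ,
    hopt i ϑ (self_mem_notBefore ϑ), hpay, R.subgamePayoff_self_eq i h𝓕 tie ϑ (plan (opponent i)),
    mem_notBefore.1 (hfeas i), mem_notBefore.1 (hfeas (opponent i)), mem_notBefore.1 hρ]
    with ω hval hlate hup hdev hle hself hi hj hmin hω
  by_contra! hne
  have hi' : ϑ.time ω < (plan i).time ω := lt_of_le_of_ne hi (Ne.symm hne.1)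
  have hj' : ϑ.time ω < (plan (opponent i)).time ω := lt_of_le_of_ne hj (Ne.symm hne.2)
  -- At such an `ω`, the value equals the payoff from deviating to `ϑ`, which is at most the
  -- equilibrium payoff and hence at most the payoff of leading at `ρ`.
  have hatt : (P[R.leader i ρ | ϑ.sigma]) ω = stopValue P ϑ (R.leader i) ω := by
    refine le_antisymm hup ?_
    rw [← hval hω, ← hself hj']
    exact hdev.trans hle
  exact absurd ((lt_min hi' hj').trans_le hmin) (not_lt.2 (hlate hω hatt))

end Revenues

end Game

end InvestmentTiming

end

theorem lemma5 {Ω : Type*} {mΩ : MeasurableSpace Ω} (P : Measure Ω) [IsProbabilityMeasure P]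
    (𝓕 : Filtration ℝ≥0 mΩ) (h𝓕 : InvestmentTiming.UsualConditions 𝓕 P)
    (R : InvestmentTiming.Revenues P 𝓕) (ϑ : InvestmentTiming.StoppingTime 𝓕) (i : Fin 2) :
    (∀ (tie : InvestmentTiming.TieRule 𝓕) (C : Set Ω), MeasurableSet C →
      InvestmentTiming.IsLatestOn P ϑ (R.leader i) ϑ C →
      ∀ plan : Fin 2 → InvestmentTiming.StoppingTime 𝓕,
        R.IsSubgameEquilibrium tie ϑ plan →
        ∀ᵐ ω ∂P, ω ∈ C → (plan 0).time ω = ϑ.time ω ∨ (plan 1).time ω = ϑ.time ω) ∧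
    (∀ C : Set Ω, MeasurableSet C →
      InvestmentTiming.AttainsOn P ϑ (R.leader i) ϑ C →
      InvestmentTiming.AttainsOn P ϑ (R.monopoly i) ϑ C) := by
  refine ⟨fun tie C _ hC plan hplan => ?_,
    fun C hC h => R.attainsOn_monopoly_of_leader i h𝓕 hC h⟩
  filter_upwards [R.immediate_investment_of_isLatestOn i h𝓕 tie hC hplan] with ω h hω
  fin_cases i
  · simpa [InvestmentTiming.opponent] using h hω
  · simpa [InvestmentTiming.opponent] using (h hω).symm
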